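/- **Theorem (correctness of the multi-head construction under Gaussian unit-norm embeddings).** *Setting.* Let $m,d,h$ be positive integers with $m=hd$, let $V=\{1,\dots,m\}$, let $\pi$ be a permutation of $V$, and consider the directed graph with edges $(i,\pi(i))$, $i\in V$. Let $V_1,\dots,V_h$ be any partition of $V$ into blocks of size $d$, and put $T_k=\pi(V_k)$. Draw independent $\tilde x_1,\dots,\tilde x_m\sim\mathcal N(0,I_d/d)$, put $x_i=\tilde x_i/\|\tilde x_i\|_2$, and let $X\in\mathbb R^{m\times d}$ be the matrix with rows $x_i$. Independently of $X$, draw $W\in\{\pm1\}^{m\times d_k}$ with i.i.d. Rademacher entries and rows $w_j$. For each head $k\in\{1,\dots,h\}$, let $W'_{Q,(k)}\in\mathbb R^{m\times d_k}$ have $i$-th row $w_{\pi(i)}$ if $i\in V_k$ and $0$ otherwise, let $W'_{K,(k)}\in\mathbb R^{m\times d_k}$ have $j$-th row $w_j$ if $j\in T_k$ and $0$ otherwise, and set $$W_Q^{(k)}=X^\top W'_{Q,(k)},\quad W_K^{(k)}=X^\top W'_{K,(k)},\quad S^{(k)}_{ij}=\langle x_iW_Q^{(k)},\,x_jW_K^{(k)}\rangle,\quad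 S^{\max}_{ij}=\max_{1\le k\le h}S^{(k)}_{ij},\quad \tau=\tfrac12 d_k .$$ For a set $P\subseteq V\times V$ of tested pairs, call the construction *correct on $P$* if all of the following hold. 1. For every $i\in V$ there is a head $k$ with $i\in V_k$, $S^{(k)}_{i,\pi(i)}>\tau$, and $S^{(k)}_{ij}<\tau$ for all $j\ne\pi(i)$ with $(i,j)\in P$. 2. For every $i\in V$, $S^{\max}_{i,\pi(i)}>\tau$, and $S^{\max}_{ij}<\tau$ for all $j\neq\pi(i)$ with $(i,j)\in P$. 3. For every context $\mathcal C\subseteq V$ and all $i,j\in\mathcal C$ with $(i,j)\in P$: $S^{\max}_{ij}>\tau$ if and only if $j=\pi(i)$. 4. For every context $\mathcal C\subseteq V$ and every $i\in\mathcal C$, with candidate set $\mathcal C_i=\{j\in\mathcal C:(i,j)\in P\}$, the rule "predict the unique $j\in\mathcal C_i$ with $S^{\max}_{ij}>\tau$ if there is exactly one, and 'no target in context' otherwise" returns $\pi(i)$ if $\pi(i)\in\mathcal C_i$, and 'no target in context' if $\pi(i)\notin\mathcal C_i$. *Claim.* There are absolute constants $C_0,c_0>0$ such that for every $C\ge C_0$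 there are constants $a,A>0$ depending only on $C$ with the following property. For all $m,d,h$ as above with $d\ge c_0\log m$, with $d_k=\lceil C\log m\rceil$: * for every permutation $\pi$ of $V$ and every partition of $V$ into $h$ blocks of size $d$, with probability at least $1-m^{-3}$ over the draw of $(X,W)$, the construction is correct on the loop-free pairs $P=\{(i,j):i\ne j\}$; * if moreover $\pi(i)\ne i$ for all $i$ (the graph has no self-loops), then with probability at least $1-m^{-3}$ the construction is correct on all pairs $P=V\times V$; * the total key dimension $D_K=h\,d_k$ satisfies $a\,\frac{m\log m}{d}\le D_K\le A\,\frac{m\log m}{d}$, that is, $D_K=\Theta\big(\frac{m\log m}{d}\big)$. -/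

import Mathlib

open MeasureTheory ProbabilityTheory Matrix
open scoped NNReal ENNReal

namespace RGR

noncomputable section

/-! ### The random inputs -/

/-- The Rademacher law on `{-1, 1}`, as a measure on `ℝ`. -/
def rademacher : Measure ℝ :=
  (2⁻¹ : ℝ≥0∞) • Measure.dirac 1 + (2⁻¹ : ℝ≥0∞) • Measure.dirac (-1)

instance : IsProbabilityMeasure rademacher :=
  ⟨by simp [rademacher, ENNReal.inv_two_add_inv_two]⟩

/-- The law of the unnormalised embeddings: `m` independent vectors of law `N(0, I / d)`. -/
def gaussianLaw (m d : ℕ) : Measure (Fin m → Fin d → ℝ) :=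
  Measure.pi fun _ => Measure.pi fun _ => gaussianReal 0 ((d : ℝ≥0)⁻¹)

/-- The law of the signature matrix: independent Rademacher entries. -/
def signatureLaw (m dk : ℕ) : Measure (Fin m → Fin dk → ℝ) :=
  Measure.pi fun _ => Measure.pi fun _ => rademacher

/-- The joint law of the unnormalised embeddings and the (independent) signatures. -/
def drawLaw (m d dk : ℕ) : Measure ((Fin m → Fin d → ℝ) × (Fin m → Fin dk → ℝ)) :=
  (gaussianLaw m d).prod (signatureLaw m dk)

/-- The matrix `X` whose `i`-th row is `g i / ‖g i‖₂`. -/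
def embedding {m d : ℕ} (g : Fin m → Fin d → ℝ) : Matrix (Fin m) (Fin d) ℝ :=
  Matrix.of fun i => ‖WithLp.toLp 2 (g i)‖⁻¹ • g i

/-! ### The multi-head construction

`π` is the permutation, `b i` is the index of the block containing `i` (so that
`V_k = {i | b i = k}` and `T_k = π(V_k) = {j | b (π⁻¹ j) = k}`), `X` is the embedding matrix, and
`W` is the signature matrix. -/

section Construction

variable {m d dk h : ℕ}

/-- Query template of head `k`: row `i` is `w_{π i}` if `i ∈ V_k`, and `0` otherwise. -/
def queryTemplate (π : Equiv.Perm (Fin m)) (b : Fin m → Fin h) (W : Fin m → Fin dk → ℝ)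
    (k : Fin h) : Matrix (Fin m) (Fin dk) ℝ :=
  Matrix.of fun i => if b i = k then W (π i) else 0

/-- Key template of head `k`: row `j` is `w_j` if `j ∈ T_k`, and `0` otherwise. -/
def keyTemplate (π : Equiv.Perm (Fin m)) (b : Fin m → Fin h) (W : Fin m → Fin dk → ℝ)
    (k : Fin h) : Matrix (Fin m) (Fin dk) ℝ :=
  Matrix.of fun j => if b (π.symm j) = k then W j else 0

/-- `W_Q^{(k)} = Xᵀ W'_{Q,(k)}`. -/
def queryWeights (π : Equiv.Perm (Fin m)) (b : Fin m → Fin h) (X : Matrix (Fin m) (Fin d) ℝ)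
    (W : Fin m → Fin dk → ℝ) (k : Fin h) : Matrix (Fin d) (Fin dk) ℝ :=
  Xᵀ * queryTemplate π b W k

/-- `W_K^{(k)} = Xᵀ W'_{K,(k)}`. -/
def keyWeights (π : Equiv.Perm (Fin m)) (b : Fin m → Fin h) (X : Matrix (Fin m) (Fin d) ℝ)
    (W : Fin m → Fin dk → ℝ) (k : Fin h) : Matrix (Fin d) (Fin dk) ℝ :=
  Xᵀ * keyTemplate π b W k

/-- The score `S_{ij}^{(k)} = ⟨x_i W_Q^{(k)}, x_j W_K^{(k)}⟩` of head `k`. -/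
def headScore (π : Equiv.Perm (Fin m)) (b : Fin m → Fin h) (X : Matrix (Fin m) (Fin d) ℝ)
    (W : Fin m → Fin dk → ℝ) (k : Fin h) (i j : Fin m) : ℝ :=
  (X i ᵥ* queryWeights π b X W k) ⬝ᵥ (X j ᵥ* keyWeights π b X W k)

/-- The aggregated score `S_{ij}^{max} = max_k S_{ij}^{(k)}`. -/
def maxScore (π : Equiv.Perm (Fin m)) (b : Fin m → Fin h) (X : Matrix (Fin m) (Fin d) ℝ)
    (W : Fin m → Fin dk → ℝ) (i j : Fin m) : ℝ :=
  ⨆ k : Fin h, headScore π b X W k i j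

end Construction

/-! ### Recognition -/

open Classical in
/-- The prediction rule for a source, given its scores `s j` against the candidate targets `j` and
a threshold `τ`: the unique candidate above the threshold, if there is one. `none` stands for
"no target in context". -/
def predict {m : ℕ} (s : Fin m → ℝ) (τ : ℝ) (cand : Set (Fin m)) : Option (Fin m) :=
  if hu : ∃! j, j ∈ cand ∧ τ < s j then some hu.choose else none

open Classical in
/-- All the correctness claims about given scores `S k i j` of the heads `k`, their maximum
`Smax i j` and a threshold `τ`, for the graph with edges `(i, π i)`; only the pairs `(i, j)` with
`tested i j` are considered as possible non-edges and as candidate pairs in a context. -/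
structure Correct {m h : ℕ} (π : Equiv.Perm (Fin m)) (b : Fin m → Fin h)
    (tested : Fin m → Fin m → Prop) (S : Fin h → Fin m → Fin m → ℝ) (Smax : Fin m → Fin m → ℝ)
    (τ : ℝ) : Prop where
  /-- The head responsible for a source separates its target from the non-targets. -/
  head_separation : ∀ i, ∃ k, b i = k ∧ τ < S k i (π i) ∧
    ∀ j, j ≠ π i → tested i j → S k i j < τ
  /-- So does the aggregated score. -/
  max_separation : ∀ i, τ < Smax i (π i) ∧ ∀ j, j ≠ π i → tested i j → Smax i j < τ
  /-- In every context `c`, the tested pairs above the threshold are exactly the tested edges. -/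
  recognizes : ∀ c : Finset (Fin m), ∀ i ∈ c, ∀ j ∈ c, tested i j → (τ < Smax i j ↔ j = π i)
  /-- In every context `c`, the prediction rule returns the target of each source, or `none` if
  the target is not among the candidates. -/
  predicts : ∀ c : Finset (Fin m), ∀ i ∈ c,
    predict (Smax i) τ {j | j ∈ c ∧ tested i j} =
      if π i ∈ c ∧ tested i (π i) then some (π i) else none

/-- The construction, run with threshold `dk / 2` on the unnormalised embeddings `ω.1` and the
signatures `ω.2`, is correct on the tested pairs. -/
def ConstructionCorrect {m d dk h : ℕ} (π : Equiv.Perm (Fin m)) (b : Fin m → Fin h)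
    (tested : Fin m → Fin m → Prop) (ω : (Fin m → Fin d → ℝ) × (Fin m → Fin dk → ℝ)) : Prop :=
  Correct π b tested (headScore π b (embedding ω.1) ω.2) (maxScore π b (embedding ω.1) ω.2)
    ((dk : ℝ) / 2)

/-- The per-head width `C log m`, rounded up to an integer. -/
def headDim (C : ℝ) (m : ℕ) : ℕ := ⌈C * Real.log m⌉₊

/-- The total key dimension `D_K = h d_k`. -/
def totalKeyDim (h dk : ℕ) : ℕ := h * dk

end

end RGR

/-! Write `G` for the Gram matrix of the embeddings. Given the embeddings, the score of head `k` at
`(i, j)` is a sum over the `dk` independent columns of `W` of products of two linear forms, whose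
coefficient vectors are a column of `G` restricted to `V_k` and one restricted to `T_k`
(`headScore_eq`). Its conditional mean is `dk` times `∑ a ∈ V_k, G a i * G (π a) j`. It suffices
that this sum is at least 3/4 for an edge in its own head, at most 1/4 for a non-edge in every head,
and that all deviations stay below `dk / 8`; the threshold `dk / 2` then separates the two cases.

Deviations: the squared coefficient norms are at most 33, because a block has only `d` elements and
the off-diagonal entries of `G` have size about `1/√d`. A Bernstein bound for products of
projections of a Rademacher vector (`IsSubGaussian.lintegral_eexp_mul_mul`,
`signatureLaw_deviation`) gives failure probability exponentially small in `dk`.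

Mean: at most four terms of the sum involve `i` or `j` in a special way. The others are split by the
order of `a` and `π a`. If `a < π a`, revealing the embeddings in increasing order makes the factor
`G (π a) j` fresh when `G a i` is already known, so the sum is a martingale and its exponential is
controlled by the compensator `∑ G a i ^ 2` (`lintegral_eexp_gram_mul_gram_predecessor`). The case
`π a < a` is symmetric. If `π a = a`, the sum concentrates around a multiple, at most 1, of `G i j`
(`lintegral_eexp_gram_mul_gram`). This is small only for `i ≠ j`, which is why self-loops and
diagonal pairs cannot both be admitted.

Normalised Gaussian vectors are replaced by `truncNormalize`, which agrees with the normalisation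
off an event of exponentially small probability, and is sub-Gaussian by comparison with the Gaussian
vector and isotropic by symmetry. A union bound over `m * m * h` triples of indices ends the proof.
Exponential moments are taken in `ℝ≥0∞`, so most steps require no integrability. -/

namespace RGR

/-! ### Exponentials with values in `ℝ≥0∞` -/

/-- The exponential, as an extended nonnegative real. -/
noncomputable def eexp (t : ℝ) : ℝ≥0∞ := ENNReal.ofReal (Real.exp t)

theorem eexp_add (s t : ℝ) : eexp (s + t) = eexp s * eexp t := by
  rw [eexp, Real.exp_add, ENNReal.ofReal_mul (Real.exp_pos s).le]; rfl

theorem eexp_zero : eexp 0 = 1 := by simp [eexp]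

theorem eexp_mono {s t : ℝ} (h : s ≤ t) : eexp s ≤ eexp t :=
  ENNReal.ofReal_le_ofReal (Real.exp_le_exp.2 h)

theorem eexp_sum {ι : Type*} (s : Finset ι) (f : ι → ℝ) :
    eexp (∑ i ∈ s, f i) = ∏ i ∈ s, eexp (f i) := by
  rw [eexp, Real.exp_sum, ENNReal.ofReal_prod_of_nonneg fun i _ => (Real.exp_pos _).le]; rfl

theorem eexp_nsmul (n : ℕ) (t : ℝ) : eexp t ^ n = eexp (n * t) := by
  rw [eexp, ← ENNReal.ofReal_pow (Real.exp_pos t).le, ← Real.exp_nat_mul]; rfl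

@[fun_prop]
theorem measurable_eexp : Measurable eexp := by unfold eexp; fun_prop

/-- The exponential Markov inequality. -/
theorem measure_le_of_lintegral_eexp {Ω : Type*} [MeasurableSpace Ω] (μ : Measure Ω) {f : Ω → ℝ}
    (hf : Measurable f) {r c : ℝ} (h : ∫⁻ ω, eexp (f ω) ∂μ ≤ eexp r) :
    μ {ω | c ≤ f ω} ≤ eexp (r - c) := by
  have h1 : eexp c * μ {ω | eexp c ≤ eexp (f ω)} ≤ eexp r :=
    (mul_meas_ge_le_lintegral (by fun_prop) _).trans h
  have h2 : μ {ω | c ≤ f ω} ≤ μ {ω | eexp c ≤ eexp (f ω)} :=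
    measure_mono fun ω hω => eexp_mono hω
  calc μ {ω | c ≤ f ω} = eexp (-c) * (eexp c * μ {ω | c ≤ f ω}) := by
        rw [← mul_assoc, ← eexp_add]; simp [eexp_zero]
    _ ≤ eexp (-c) * eexp r := by gcongr; exact (by gcongr : _ ≤ _).trans h1
    _ = eexp (r - c) := by rw [← eexp_add]; congr 1; ring

/-! ### Product measures -/

/-- Integrating against a product of probability measures is not changed by resampling one
coordinate. -/
theorem lintegral_pi_update {ι E : Type*} [Fintype ι] [DecidableEq ι] [MeasurableSpace E]
    (ν : Measure E) [IsProbabilityMeasure ν] {F : (ι → E) → ℝ≥0∞} (hF : Measurable F) (i : ι) :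
    ∫⁻ x, F x ∂(Measure.pi fun _ => ν) =
      ∫⁻ x, ∫⁻ y, F (Function.update x i y) ∂ν ∂(Measure.pi fun _ => ν) := by
  have hG : Measurable (lmarginal (fun _ : ι => ν) {i} F) := hF.lmarginal _
  have h1 : ∀ x, ∫⁻ y, F (Function.update x i y) ∂ν = lmarginal (fun _ : ι => ν) {i} F x :=
    fun x => by rw [lmarginal_singleton]
  simp_rw [h1]
  -- Integrating out the same coordinate twice changes nothing, so both integrands have the same
  -- marginal.
  refine lintegral_eq_of_lmarginal_eq {i} hF hG ?_
  ext x
  rw [lmarginal_singleton (μ := fun _ : ι => ν) (lmarginal (fun _ : ι => ν) {i} F)]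
  have : ∀ y, lmarginal (fun _ : ι => ν) {i} F (Function.update x i y) =
      lmarginal (fun _ : ι => ν) {i} F x := fun y =>
    lmarginal_update_of_mem _ (Finset.mem_singleton_self i) F x y
  simp [this]

/-- The integral of a product of functions of separate coordinates. -/
theorem lintegral_pi_prod {ι E : Type*} [Fintype ι] [MeasurableSpace E]
    (ν : ι → Measure E) [∀ i, IsProbabilityMeasure (ν i)] {f : ι → E → ℝ≥0∞}
    (hf : ∀ i, Measurable (f i)) :
    ∫⁻ x, ∏ i, f i (x i) ∂(Measure.pi ν) = ∏ i, ∫⁻ y, f i y ∂(ν i) := by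
  have h := (iIndepFun_pi (μ := ν) (X := fun i => f i) fun i => (hf i).aemeasurable)
  have := lintegral_prod_eq_prod_lintegral_of_indepFun Finset.univ
    (fun i (x : ι → E) => f i (x i)) h
    (fun i => (hf i).comp (measurable_pi_apply i))
  rw [this]
  refine Finset.prod_congr rfl fun i _ => ?_
  exact (measurePreserving_eval ν i).lintegral_comp (hf i)

/-- Exchanging the two indices of a doubly indexed family of independent variables. -/
theorem map_pi_swap {ι κ : Type*} [Fintype ι] [Fintype κ] (ρ : Measure ℝ)
    [IsProbabilityMeasure ρ] :
    (Measure.pi fun _ : ι => Measure.pi fun _ : κ => ρ).map (fun W l a => W a l) =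
      Measure.pi fun _ : κ => Measure.pi fun _ : ι => ρ := by
  have hs : Measurable fun (W : ι → κ → ℝ) (l : κ) (a : ι) => W a l := by fun_prop
  symm
  -- Boxes of boxes generate the σ-algebra, and on them both measures are the same double product.
  refine Measure.pi_eq_generateFrom
    (C := fun _ : κ => Set.pi Set.univ '' Set.pi Set.univ fun _ : ι => {s : Set ℝ | MeasurableSet s})
    (fun _ => generateFrom_pi) (fun _ => isPiSystem_pi)
    (fun _ => Measure.FiniteSpanningSetsIn.pi fun _ => ρ.toFiniteSpanningSetsIn) ?_
  intro s hs'
  choose t ht hts using hs'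
  have ht' : ∀ l a, MeasurableSet (t l a) := fun l a => ht l a (Set.mem_univ a)
  obtain rfl : (fun l => Set.univ.pi (t l)) = s := funext hts
  rw [Measure.map_apply hs (.univ_pi fun l => .univ_pi fun a => ht' l a)]
  have : (fun (W : ι → κ → ℝ) (l : κ) (a : ι) => W a l) ⁻¹' Set.univ.pi (fun l => Set.univ.pi (t l))
      = Set.univ.pi fun a => Set.univ.pi fun l => t l a := by
    ext W; simp only [Set.mem_preimage, Set.mem_pi, Set.mem_univ, true_implies]; exact forall_comm
  rw [this]
  simp only [Measure.pi_pi]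
  exact Finset.prod_comm

/-- A bound on a measurable set of a product space from bounds on its sections. -/
theorem prod_measure_le_of_sections {α β : Type*} [MeasurableSpace α] [MeasurableSpace β]
    (μ : Measure α) [IsProbabilityMeasure μ] (ν : Measure β) [IsProbabilityMeasure ν]
    {s : Set (α × β)} (hs : MeasurableSet s) {ε : ℝ≥0∞} (h : ∀ x, ν {y | (x, y) ∈ s} ≤ ε) :
    (μ.prod ν) s ≤ ε := by
  rw [Measure.prod_apply hs]
  calc ∫⁻ x, ν (Prod.mk x ⁻¹' s) ∂μ ≤ ∫⁻ _, ε ∂μ := lintegral_mono h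
    _ = ε := by simp

theorem measure_exists_le {Ω ι : Type*} [MeasurableSpace Ω] [Fintype ι] (μ : Measure Ω)
    {p : ι → Ω → Prop} {ε : ℝ≥0∞} (h : ∀ i, μ {ω | p i ω} ≤ ε) :
    μ {ω | ∃ i, p i ω} ≤ Fintype.card ι * ε := by
  rw [Set.ofPred_exists]
  refine (measure_iUnion_fintype_le μ _).trans ?_
  calc ∑ i, μ {ω | p i ω} ≤ ∑ _ : ι, ε := Finset.sum_le_sum fun i _ => h i
    _ = Fintype.card ι * ε := by simp

/-! ### Gaussian integrals -/

theorem lintegral_eexp_mul_gaussianReal (v : ℝ≥0) (t : ℝ) :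
    ∫⁻ x, eexp (t * x) ∂(gaussianReal 0 v) = eexp (v * t ^ 2 / 2) := by
  have h := congrFun (mgf_fun_id_gaussianReal (μ := 0) (v := v)) t
  simp only [mgf, zero_mul, zero_add] at h
  unfold eexp
  rw [← h, ofReal_integral_eq_lintegral_ofReal]
  · exact integrable_exp_mul_gaussianReal t
  · exact ae_of_all _ fun x => (Real.exp_pos _).le

theorem lintegral_eexp_mul_sq_gaussianReal {c : ℝ} (hc : c < 1 / 2) :
    ∫⁻ x, eexp (c * x ^ 2) ∂(gaussianReal 0 1) = ENNReal.ofReal (√(1 - 2 * c))⁻¹ := by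
  rw [gaussianReal_of_var_ne_zero 0 one_ne_zero,
    lintegral_withDensity_eq_lintegral_mul _ (measurable_gaussianPDF 0 1) (by fun_prop)]
  have h1 : ∀ x, (gaussianPDF 0 1 * fun x => eexp (c * x ^ 2)) x =
      ENNReal.ofReal ((√(2 * Real.pi))⁻¹ * Real.exp (-(1 / 2 - c) * x ^ 2)) := fun x => by
    rw [Pi.mul_apply, gaussianPDF, eexp, ← ENNReal.ofReal_mul (gaussianPDFReal_nonneg _ _ _),
      gaussianPDFReal]
    congr 1
    rw [mul_assoc, ← Real.exp_add]
    simp only [NNReal.coe_one, mul_one, sub_zero]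
    congr 2; ring
  simp_rw [h1]
  rw [← ofReal_integral_eq_lintegral_ofReal, integral_const_mul, integral_gaussian]
  · congr 1
    rw [← Real.sqrt_inv, ← Real.sqrt_inv, ← Real.sqrt_mul (by positivity)]
    congr 1
    have : 1 - 2 * c ≠ 0 := by linarith
    have : 1 / 2 - c ≠ 0 := by linarith
    field_simp
  · exact (integrable_exp_neg_mul_sq (by linarith)).const_mul _
  · exact ae_of_all _ fun x => by positivity

theorem lintegral_eexp_sq_div_gaussianReal {c : ℝ} (hc : c < 1 / 2) {v : ℝ≥0} (hv : v ≠ 0) :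
    ∫⁻ x, eexp (c * (x ^ 2 / v)) ∂(gaussianReal 0 v) = ENNReal.ofReal (√(1 - 2 * c))⁻¹ := by
  have h := gaussianReal_map_const_mul (μ := 0) (v := 1) (√v)
  have hv2 : NNReal.mk ((√(v : ℝ)) ^ 2) (sq_nonneg _) * 1 = v := by
    ext; simp
  rw [mul_zero, hv2] at h
  rw [← h, lintegral_map (by fun_prop) (by fun_prop), ← lintegral_eexp_mul_sq_gaussianReal hc]
  refine lintegral_congr fun x => ?_
  have : (v : ℝ) ≠ 0 := by exact_mod_cast hv
  rw [mul_pow, Real.sq_sqrt v.coe_nonneg]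
  congr 2
  field_simp

/-! ### Sub-Gaussian vectors -/

variable {n : Type*} [Fintype n]

/-- The coordinate projections of a random vector of law `ν` in the direction `y` are sub-Gaussian
with variance proxy `κ ‖y‖²`. -/
def IsSubGaussian (κ : ℝ) (ν : Measure (n → ℝ)) : Prop :=
  ∀ y : n → ℝ, ∫⁻ x, eexp (x ⬝ᵥ y) ∂ν ≤ eexp (κ / 2 * (y ⬝ᵥ y))

/-- The coordinates are uncorrelated with second moment `σ`. -/
def IsIsotropic [DecidableEq n] (σ : ℝ) (ν : Measure (n → ℝ)) : Prop :=
  ∀ p q, Integrable (fun x => x p * x q) ν ∧ ∫ x, x p * x q ∂ν = if p = q then σ else 0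

@[fun_prop]
theorem measurable_dotProduct_comp {Ω : Type*} [MeasurableSpace Ω] {f g : Ω → n → ℝ}
    (hf : Measurable f) (hg : Measurable g) : Measurable fun ω => f ω ⬝ᵥ g ω := by
  unfold dotProduct; fun_prop

variable {κ : ℝ} {ν : Measure (n → ℝ)}

theorem IsSubGaussian.lintegral_eexp_mul (hν : IsSubGaussian κ ν) (t : ℝ) (y : n → ℝ) :
    ∫⁻ x, eexp (t * (x ⬝ᵥ y)) ∂ν ≤ eexp (κ / 2 * (t ^ 2 * (y ⬝ᵥ y))) := by
  have := hν (t • y)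
  simp only [dotProduct_smul, smul_dotProduct, smul_eq_mul] at this
  rwa [← mul_assoc t t, ← sq] at this

/-- Gaussian linearisation: `exp (s z²)` is the mean of `exp (√(2s) z g)` over a standard normal
`g`. After exchanging the integrals, the sub-Gaussian bound leaves at most the mean of `exp (3 g² /
8)`, which is `(1 - 3/4)^(-1/2) = 2`. -/
theorem IsSubGaussian.lintegral_eexp_sq [IsProbabilityMeasure ν] (hν : IsSubGaussian κ ν) {s : ℝ}
    (hs : 0 ≤ s) {y : n → ℝ} (hy : s * κ * (y ⬝ᵥ y) ≤ 3 / 8) :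
    ∫⁻ x, eexp (s * (x ⬝ᵥ y) ^ 2) ∂ν ≤ 2 := by
  have h1 : ∀ x : n → ℝ, eexp (s * (x ⬝ᵥ y) ^ 2) =
      ∫⁻ g, eexp (√(2 * s) * (x ⬝ᵥ y) * g) ∂(gaussianReal 0 1) := fun x => by
    rw [lintegral_eexp_mul_gaussianReal, mul_pow, Real.sq_sqrt (by positivity)]
    congr 1; push_cast; ring
  simp_rw [h1]
  rw [lintegral_lintegral_swap (by fun_prop)]
  calc ∫⁻ g, ∫⁻ x, eexp (√(2 * s) * (x ⬝ᵥ y) * g) ∂ν ∂(gaussianReal 0 1)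
      ≤ ∫⁻ g, eexp (3 / 8 * g ^ 2) ∂(gaussianReal 0 1) := lintegral_mono fun g => by
        have := hν.lintegral_eexp_mul (√(2 * s) * g) y
        rw [mul_pow, Real.sq_sqrt (by positivity)] at this
        refine le_trans (le_of_eq ?_) (this.trans (eexp_mono ?_))
        · simp only [mul_right_comm]
        · nlinarith [mul_le_mul_of_nonneg_right hy (sq_nonneg g)]
    _ = 2 := by
        rw [lintegral_eexp_mul_sq_gaussianReal (by norm_num)]
        have : √(1 - 2 * (3 / 8 : ℝ)) = 1 / 2 := by
          rw [show (1 - 2 * (3 / 8 : ℝ)) = (1 / 2) ^ 2 by norm_num]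
          exact Real.sqrt_sq (by norm_num)
        rw [this]; norm_num

theorem integral_dotProduct_mul_dotProduct [DecidableEq n] {σ : ℝ} (hν : IsIsotropic σ ν)
    (u v : n → ℝ) :
    Integrable (fun x => (x ⬝ᵥ u) * (x ⬝ᵥ v)) ν ∧
      ∫ x, (x ⬝ᵥ u) * (x ⬝ᵥ v) ∂ν = σ * (u ⬝ᵥ v) := by
  have h1 : ∀ x : n → ℝ, (x ⬝ᵥ u) * (x ⬝ᵥ v) = ∑ p, ∑ q, (u p * v q) * (x p * x q) := fun x => by
    rw [dotProduct, dotProduct, Finset.sum_mul_sum]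
    exact Finset.sum_congr rfl fun p _ => Finset.sum_congr rfl fun q _ => by ring
  have hi : ∀ p q, Integrable (fun x => (u p * v q) * (x p * x q)) ν :=
    fun p q => (hν p q).1.const_mul _
  simp_rw [h1]
  refine ⟨integrable_finsetSum _ fun p _ => integrable_finsetSum _ fun q _ => hi p q, ?_⟩
  rw [integral_finsetSum _ fun p _ => integrable_finsetSum _ fun q _ => hi p q]
  simp_rw [integral_finsetSum _ fun q _ => hi _ q, integral_const_mul, (hν _ _).2]
  simp only [mul_ite, mul_zero, Finset.sum_ite_eq, Finset.mem_univ, if_true]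
  rw [dotProduct, Finset.mul_sum]
  exact Finset.sum_congr rfl fun p _ => by ring

theorem exp_sub_one_sub_id_le_sq_mul_exp_abs (w : ℝ) :
    Real.exp w - 1 - w ≤ w ^ 2 * Real.exp |w| := by
  have h1 : 1 ≤ Real.exp |w| := Real.one_le_exp (abs_nonneg w)
  rcases le_or_gt |w| 1 with h | h
  · have := (abs_le.1 (Real.abs_exp_sub_one_sub_id_le h)).2
    nlinarith [sq_nonneg w]
  · have h2 : 1 ≤ w ^ 2 := by rw [← sq_abs]; nlinarith
    rcases le_or_gt 0 w with h0 | h0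
    · rw [abs_of_nonneg h0] at *
      nlinarith
    · rw [abs_of_neg h0] at *
      have : Real.exp w ≤ 1 := Real.exp_le_one_iff.2 h0.le
      nlinarith

/-- Since `r ≤ 1/2`, the Taylor remainder `w² exp |w|` uses only half of the exponent `z`; the other
half absorbs `z²` through `z² ≤ 8 exp (z/2)`. -/
theorem exp_le_one_add_add {w z r : ℝ} (hz : 0 ≤ z) (hr : r ≤ 1 / 2)
    (hw : |w| = r * z) : Real.exp w ≤ 1 + w + 8 * r ^ 2 * Real.exp z := by
  have h1 := exp_sub_one_sub_id_le_sq_mul_exp_abs w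
  have h2 : Real.exp |w| ≤ Real.exp (z / 2) := Real.exp_le_exp.2 (by rw [hw]; nlinarith)
  have h3 : (z / 2) ^ 2 / 2 ≤ Real.exp (z / 2) := by
    have := Real.quadratic_le_exp_of_nonneg (x := z / 2) (by positivity)
    nlinarith
  have h4 : Real.exp z = Real.exp (z / 2) * Real.exp (z / 2) := by rw [← Real.exp_add]; ring_nf
  have h5 : w ^ 2 = r ^ 2 * z ^ 2 := by rw [← sq_abs, hw]; ring
  have h6 : w ^ 2 * Real.exp |w| ≤ r ^ 2 * z ^ 2 * Real.exp (z / 2) := by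
    rw [h5]; gcongr
  have h7 : r ^ 2 * z ^ 2 * Real.exp (z / 2) ≤ r ^ 2 * (8 * Real.exp (z / 2)) * Real.exp (z / 2) := by
    gcongr; linarith
  rw [h4]; linarith

/-- A Bernstein type bound for the moment generating function of a product of two projections of a
sub-Gaussian vector. -/
theorem IsSubGaussian.lintegral_eexp_mul_mul [DecidableEq n] [IsProbabilityMeasure ν]
    (hν : IsSubGaussian κ ν) {σ : ℝ} (hi : IsIsotropic σ ν) (hκ : 0 < κ) {β : ℝ} (hβ : 0 < β)
    {u v : n → ℝ} (hu : u ⬝ᵥ u ≤ β) (hv : v ⬝ᵥ v ≤ β) {t : ℝ} (ht : |t| * (κ * β) ≤ 3 / 16) :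
    ∫⁻ x, eexp (t * ((x ⬝ᵥ u) * (x ⬝ᵥ v))) ∂ν ≤
      eexp (t * (σ * (u ⬝ᵥ v)) + 114 * (t * (κ * β)) ^ 2) := by
  have hκβ : 0 < κ * β := by positivity
  -- The largest parameter for which `IsSubGaussian.lintegral_eexp_sq` applies to both `u` and `v`.
  set θ : ℝ := 3 / (8 * (κ * β)) with hθ
  have hθ0 : 0 < θ := by positivity
  have hθκ : θ * κ * β = 3 / 8 := by rw [hθ]; field_simp
  have hsq : ∀ y : n → ℝ, y ⬝ᵥ y ≤ β → ∫⁻ x, eexp (θ * (x ⬝ᵥ y) ^ 2) ∂ν ≤ 2 := fun y hy =>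
    hν.lintegral_eexp_sq hθ0.le
      ((mul_le_mul_of_nonneg_left hy (by positivity)).trans_eq hθκ)
  have hbound : ∫⁻ x, eexp (θ * |(x ⬝ᵥ u) * (x ⬝ᵥ v)|) ∂ν ≤ 2 := by
    calc ∫⁻ x, eexp (θ * |(x ⬝ᵥ u) * (x ⬝ᵥ v)|) ∂ν
        ≤ ∫⁻ x, (2⁻¹ * eexp (θ * (x ⬝ᵥ u) ^ 2) + 2⁻¹ * eexp (θ * (x ⬝ᵥ v) ^ 2)) ∂ν := by
          refine lintegral_mono fun x => ?_
          have h2 : (2⁻¹ : ℝ≥0∞) = ENNReal.ofReal 2⁻¹ := by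
            rw [ENNReal.ofReal_inv_of_pos (by norm_num)]; norm_num
          simp only [eexp]
          rw [h2, ← ENNReal.ofReal_mul (by norm_num), ← ENNReal.ofReal_mul (by norm_num),
            ← ENNReal.ofReal_add (by positivity) (by positivity)]
          refine ENNReal.ofReal_le_ofReal ?_
          set p := x ⬝ᵥ u
          set q := x ⬝ᵥ v
          have h3 : θ * |p * q| ≤ θ * p ^ 2 / 2 + θ * q ^ 2 / 2 := by
            rw [abs_mul, ← sq_abs p, ← sq_abs q]
            nlinarith [mul_nonneg hθ0.le (sq_nonneg (|p| - |q|))]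
          refine (Real.exp_le_exp.2 h3).trans ?_
          have e1 : Real.exp (θ * p ^ 2) = Real.exp (θ * p ^ 2 / 2) ^ 2 := by
            rw [← Real.exp_nat_mul]; congr 1; push_cast; ring
          have e2 : Real.exp (θ * q ^ 2) = Real.exp (θ * q ^ 2 / 2) ^ 2 := by
            rw [← Real.exp_nat_mul]; congr 1; push_cast; ring
          rw [Real.exp_add, e1, e2]
          nlinarith [sq_nonneg (Real.exp (θ * p ^ 2 / 2) - Real.exp (θ * q ^ 2 / 2))]
      _ = 2⁻¹ * ∫⁻ x, eexp (θ * (x ⬝ᵥ u) ^ 2) ∂ν + 2⁻¹ * ∫⁻ x, eexp (θ * (x ⬝ᵥ v) ^ 2) ∂ν := by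
          rw [lintegral_add_left (by fun_prop), lintegral_const_mul _ (by fun_prop),
            lintegral_const_mul _ (by fun_prop)]
      _ ≤ 2⁻¹ * 2 + 2⁻¹ * 2 := by gcongr <;> [exact hsq u hu; exact hsq v hv]
      _ = 2 := by rw [ENNReal.inv_mul_cancel two_ne_zero (by simp)]; norm_num
  obtain ⟨hI, hInt⟩ := integral_dotProduct_mul_dotProduct hi u v
  have hm : Measurable fun x : n → ℝ => Real.exp (θ * |(x ⬝ᵥ u) * (x ⬝ᵥ v)|) := by
    have : Measurable fun x : n → ℝ => (x ⬝ᵥ u) * (x ⬝ᵥ v) := by fun_prop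
    exact ((this.norm).const_mul θ).exp
  have hE : Integrable (fun x : n → ℝ => Real.exp (θ * |(x ⬝ᵥ u) * (x ⬝ᵥ v)|)) ν := by
    refine ⟨hm.aestronglyMeasurable, ?_⟩
    rw [hasFiniteIntegral_iff_ofReal (ae_of_all _ fun x => (Real.exp_pos _).le)]
    exact hbound.trans_lt (by simp)
  have hE2 : ∫ x, Real.exp (θ * |(x ⬝ᵥ u) * (x ⬝ᵥ v)|) ∂ν ≤ 2 := by
    rw [integral_eq_lintegral_of_nonneg_ae (ae_of_all _ fun x => (Real.exp_pos _).le)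
      hm.aestronglyMeasurable]
    exact ENNReal.toReal_le_of_le_ofReal (by norm_num) (hbound.trans (by norm_num))
  set r : ℝ := |t| / θ with hr
  have hr1 : r ≤ 1 / 2 := by
    rw [hr, div_le_iff₀ hθ0]
    refine le_of_mul_le_mul_right ?_ hκβ
    rw [mul_assoc, ← mul_assoc θ, hθκ]
    linarith
  have hpt : ∀ x : n → ℝ, Real.exp (t * ((x ⬝ᵥ u) * (x ⬝ᵥ v))) ≤
      1 + t * ((x ⬝ᵥ u) * (x ⬝ᵥ v)) + 8 * r ^ 2 * Real.exp (θ * |(x ⬝ᵥ u) * (x ⬝ᵥ v)|) :=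
    fun x => exp_le_one_add_add (by positivity) hr1
      (by rw [abs_mul, hr]; field_simp)
  calc ∫⁻ x, eexp (t * ((x ⬝ᵥ u) * (x ⬝ᵥ v))) ∂ν
      ≤ ∫⁻ x, ENNReal.ofReal (1 + t * ((x ⬝ᵥ u) * (x ⬝ᵥ v)) +
          8 * r ^ 2 * Real.exp (θ * |(x ⬝ᵥ u) * (x ⬝ᵥ v)|)) ∂ν :=
        lintegral_mono fun x => ENNReal.ofReal_le_ofReal (hpt x)
    _ = ENNReal.ofReal (1 + t * (σ * (u ⬝ᵥ v)) +
          8 * r ^ 2 * ∫ x, Real.exp (θ * |(x ⬝ᵥ u) * (x ⬝ᵥ v)|) ∂ν) := by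
        have i1 : Integrable (fun x : n → ℝ => 1 + t * ((x ⬝ᵥ u) * (x ⬝ᵥ v))) ν :=
          (integrable_const _).add (hI.const_mul t)
        rw [← ofReal_integral_eq_lintegral_ofReal (f := fun x => 1 +
            t * ((x ⬝ᵥ u) * (x ⬝ᵥ v)) + 8 * r ^ 2 * Real.exp (θ * |(x ⬝ᵥ u) * (x ⬝ᵥ v)|))
          (i1.add (hE.const_mul _)) (ae_of_all _ fun x => (Real.exp_pos _).le.trans (hpt x)),
          integral_add i1 (hE.const_mul _), integral_add (integrable_const _) (hI.const_mul t),
          integral_const_mul, integral_const_mul, hInt]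
        simp
    _ ≤ eexp (t * (σ * (u ⬝ᵥ v)) + 114 * (t * (κ * β)) ^ 2) := by
        refine ENNReal.ofReal_le_ofReal (le_trans ?_ (Real.add_one_le_exp _))
        -- The remainder is at most `16 r²`, and `16 * 64 / 9 < 114`.
        have h8 : r ^ 2 = 64 / 9 * (t * (κ * β)) ^ 2 := by
          rw [hr, div_pow, sq_abs, hθ]; field_simp; ring
        have := mul_le_mul_of_nonneg_left hE2 (show 0 ≤ 8 * r ^ 2 by positivity)
        rw [h8] at this ⊢
        nlinarith [sq_nonneg (t * (κ * β))]

/-! ### Gram matrices of independent sub-Gaussian vectors -/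

section Gram

variable {E n : Type*} [Fintype n] {m : ℕ}

/-- The inner product of the `a`-th and `b`-th of the vectors `φ (x i)`. -/
def gram (φ : E → n → ℝ) (x : Fin m → E) (a b : Fin m) : ℝ := φ (x a) ⬝ᵥ φ (x b)

theorem gram_update_of_ne (φ : E → n → ℝ) (x : Fin m → E) {a b i : Fin m} (ha : a ≠ i) (hb : b ≠ i)
    (y : E) : gram φ (Function.update x i y) a b = gram φ x a b := by
  simp [gram, ha, hb]

theorem gram_update_left (φ : E → n → ℝ) (x : Fin m → E) {b i : Fin m} (hb : b ≠ i)
    (y : E) : gram φ (Function.update x i y) i b = φ y ⬝ᵥ φ (x b) := by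
  simp [gram, hb]

variable [MeasurableSpace E]

@[fun_prop]
theorem measurable_gram {φ : E → n → ℝ} (hφ : Measurable φ) (a b : Fin m) :
    Measurable fun x : Fin m → E => gram φ x a b := by
  unfold gram; fun_prop

/-- A two-sided Chernoff bound with a compensator `V`. -/
theorem measure_le_abs_and_le {Ω : Type*} [MeasurableSpace Ω] (μ : Measure Ω) {f V : Ω → ℝ}
    (hf : Measurable f) (hV : Measurable V) {l r c v : ℝ} (hl : 0 ≤ l)
    (h : ∀ t : ℝ, |t| = l → ∫⁻ ω, eexp (t * f ω - V ω) ∂μ ≤ eexp r) :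
    μ {ω | c ≤ |f ω| ∧ V ω ≤ v} ≤ 2 * eexp (r + v - l * c) := by
  have key : ∀ t : ℝ, |t| = l → μ {ω | l * c - v ≤ t * f ω - V ω} ≤ eexp (r + v - l * c) :=
    fun t ht => by
      refine (measure_le_of_lintegral_eexp μ (by fun_prop) (h t ht)).trans (eexp_mono ?_)
      linarith
  have hsub : {ω | c ≤ |f ω| ∧ V ω ≤ v} ⊆
      {ω | l * c - v ≤ l * f ω - V ω} ∪ {ω | l * c - v ≤ -l * f ω - V ω} := by
    rintro ω ⟨h1, h2⟩
    rcases le_abs.1 h1 with h3 | h3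
    · left
      have := mul_le_mul_of_nonneg_left h3 hl
      simp only [Set.mem_ofPred_eq]; linarith
    · right
      have := mul_le_mul_of_nonneg_left h3 hl
      simp only [Set.mem_ofPred_eq]; linarith
  calc _ ≤ _ := measure_mono hsub
    _ ≤ _ := measure_union_le _ _
    _ ≤ eexp (r + v - l * c) + eexp (r + v - l * c) :=
        add_le_add (key l (abs_of_nonneg hl)) (key (-l) (by rw [abs_neg, abs_of_nonneg hl]))
    _ = _ := (two_mul _).symm

variable {γ : Measure E} {φ : E → n → ℝ} {κ : ℝ}

theorem IsSubGaussian.lintegral_comp_eexp_mul (hν : IsSubGaussian κ (γ.map φ)) (hφ : Measurable φ)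
    (t : ℝ) (z : n → ℝ) :
    ∫⁻ y, eexp (t * (φ y ⬝ᵥ z)) ∂γ ≤ eexp (κ / 2 * (t ^ 2 * (z ⬝ᵥ z))) := by
  have := hν.lintegral_eexp_mul t z
  rwa [lintegral_map (by fun_prop) hφ] at this

variable [IsProbabilityMeasure γ]

theorem lintegral_eexp_gram (hν : IsSubGaussian κ (γ.map φ)) (hφ : Measurable φ) (hκ : 0 ≤ κ)
    (hb : ∀ y, φ y ⬝ᵥ φ y ≤ 1) {a b : Fin m} (hab : a ≠ b) (t : ℝ) :
    ∫⁻ x, eexp (t * gram φ x a b) ∂(Measure.pi fun _ : Fin m => γ) ≤ eexp (κ / 2 * t ^ 2) := by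
  rw [lintegral_pi_update γ (by fun_prop) a]
  simp_rw [gram_update_left φ _ hab.symm]
  calc _ ≤ ∫⁻ _, eexp (κ / 2 * t ^ 2) ∂(Measure.pi fun _ : Fin m => γ) := lintegral_mono fun x =>
        (hν.lintegral_comp_eexp_mul hφ t _).trans
          (eexp_mono (by have := hb (x b); have := mul_nonneg hκ (sq_nonneg t); nlinarith))
    _ = _ := by simp

/-- With `x i` held fixed, the vectors indexed by `T` are resampled one at a time; each costs a
factor 2 by `IsSubGaussian.lintegral_eexp_sq`. -/
theorem lintegral_eexp_sum_sq_gram (hν : IsSubGaussian κ (γ.map φ)) (hφ : Measurable φ)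
    (hb : ∀ y, φ y ⬝ᵥ φ y ≤ 1) {s : ℝ} (hs : 0 ≤ s) (hκ : 0 ≤ κ) (hsκ : s * κ ≤ 3 / 8)
    {i : Fin m} (T : Finset (Fin m)) (hi : i ∉ T) :
    ∫⁻ x, eexp (s * ∑ a ∈ T, gram φ x a i ^ 2) ∂(Measure.pi fun _ : Fin m => γ) ≤ 2 ^ T.card := by
  have := Measure.isProbabilityMeasure_map (μ := γ) hφ.aemeasurable
  induction T using Finset.induction_on with
  | empty => simp [eexp_zero]
  | insert t T ht ih =>
    have hit : i ≠ t := fun h => hi (by simp [h])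
    have hiT : i ∉ T := fun h => hi (by simp [h])
    rw [lintegral_pi_update γ (by fun_prop) t, Finset.card_insert_of_notMem ht, pow_succ']
    have h1 : ∀ (x : Fin m → E) (y : E),
        eexp (s * ∑ a ∈ insert t T, gram φ (Function.update x t y) a i ^ 2) =
          eexp (s * ∑ a ∈ T, gram φ x a i ^ 2) * eexp (s * (φ y ⬝ᵥ φ (x i)) ^ 2) := fun x y => by
      rw [Finset.sum_insert ht, gram_update_left φ x hit, mul_add, eexp_add, mul_comm]
      congr 3
      exact Finset.sum_congr rfl fun a ha => by
        have hat : a ≠ t := fun h => ht (h ▸ ha)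
        rw [gram_update_of_ne φ x hat hit]
    simp_rw [h1]
    calc _ ≤ ∫⁻ x, 2 * eexp (s * ∑ a ∈ T, gram φ x a i ^ 2) ∂(Measure.pi fun _ : Fin m => γ) := by
          refine lintegral_mono fun x => ?_
          rw [lintegral_const_mul _ (by fun_prop), mul_comm]
          gcongr
          have := hν.lintegral_eexp_sq hs (y := φ (x i))
            ((mul_le_of_le_one_right (by positivity) (hb _)).trans hsκ)
          rwa [lintegral_map (by fun_prop) hφ] at this
      _ ≤ 2 * 2 ^ T.card := by
          rw [lintegral_const_mul _ (by fun_prop)]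
          gcongr
          exact ih hiT

/-- An exponential supermartingale. The largest index `a` of `s` is resampled first: as `f b < b ≤
a` for all `b ∈ s`, and `i, j ∉ s`, the vector `x a` occurs only in the factor `gram φ x a j` of its
own term. Its sub-Gaussian cost is exactly the term of `a` in the compensator. -/
theorem lintegral_eexp_gram_mul_gram_predecessor (hν : IsSubGaussian κ (γ.map φ))
    (hφ : Measurable φ) (hκ : 0 ≤ κ) (hb : ∀ y, φ y ⬝ᵥ φ y ≤ 1) {i j : Fin m} (f : Fin m → Fin m)
    (t : ℝ) (s : Finset (Fin m)) (hi : i ∉ s) (hj : j ∉ s) (hf : ∀ a ∈ s, f a < a) :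
    ∫⁻ x, eexp (t * ∑ a ∈ s, gram φ x (f a) i * gram φ x a j -
      κ / 2 * t ^ 2 * ∑ a ∈ s, gram φ x (f a) i ^ 2) ∂(Measure.pi fun _ : Fin m => γ) ≤ 1 := by
  induction s using Finset.induction_on_max with
  | empty => simp [eexp_zero]
  | insert a s ha ih =>
    have has : a ∉ s := fun h => lt_irrefl _ (ha a h)
    have hia : i ≠ a := fun h => hi (by simp [h])
    have hja : j ≠ a := fun h => hj (by simp [h])
    have hfa : f a ≠ a := (hf a (by simp)).ne
    rw [lintegral_pi_update γ (by fun_prop) a]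
    refine le_trans (lintegral_mono fun x => ?_)
      (ih (fun h => hi (by simp [h])) (fun h => hj (by simp [h])) fun b hb => hf b (by simp [hb]))
    have hne : ∀ b ∈ s, b ≠ a ∧ f b ≠ a := fun b hb =>
      ⟨(ha b hb).ne, ((hf b (by simp [hb])).trans (ha b hb)).ne⟩
    have h1 : ∀ y : E, eexp (t * ∑ b ∈ insert a s, gram φ (Function.update x a y) (f b) i *
          gram φ (Function.update x a y) b j - κ / 2 * t ^ 2 *
          ∑ b ∈ insert a s, gram φ (Function.update x a y) (f b) i ^ 2) =
        eexp (t * ∑ b ∈ s, gram φ x (f b) i * gram φ x b j -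
          κ / 2 * t ^ 2 * ∑ b ∈ s, gram φ x (f b) i ^ 2 - κ / 2 * t ^ 2 * gram φ x (f a) i ^ 2) *
          eexp (t * gram φ x (f a) i * (φ y ⬝ᵥ φ (x j))) := fun y => by
      have e1 : ∑ b ∈ s, gram φ (Function.update x a y) (f b) i * gram φ (Function.update x a y) b j
          = ∑ b ∈ s, gram φ x (f b) i * gram φ x b j := Finset.sum_congr rfl fun b hb => by
        rw [gram_update_of_ne φ x (hne b hb).2 hia, gram_update_of_ne φ x (hne b hb).1 hja]
      have e2 : ∑ b ∈ s, gram φ (Function.update x a y) (f b) i ^ 2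
          = ∑ b ∈ s, gram φ x (f b) i ^ 2 := Finset.sum_congr rfl fun b hb => by
        rw [gram_update_of_ne φ x (hne b hb).2 hia]
      rw [Finset.sum_insert has, Finset.sum_insert has, e1, e2, gram_update_of_ne φ x hfa hia,
        gram_update_left φ x hja, ← eexp_add]
      congr 1; ring
    simp_rw [h1]
    rw [lintegral_const_mul _ (by fun_prop)]
    calc _ ≤ _ := mul_le_mul_right (hν.lintegral_comp_eexp_mul hφ _ _) _
      _ ≤ _ := by
        rw [← eexp_add]
        refine eexp_mono ?_
        have h2 := mul_le_mul_of_nonneg_left (hb (x j))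
          (show 0 ≤ κ / 2 * (t * gram φ x (f a) i) ^ 2 by positivity)
        nlinarith

/-- Given `x i` and `x j`, the summands are independent with mean `σ * gram φ x i j`, so the
Bernstein bound applies to each vector in turn. -/
theorem lintegral_eexp_gram_mul_gram [DecidableEq n] (hν : IsSubGaussian κ (γ.map φ))
    (hφ : Measurable φ) {σ : ℝ} (hσ : IsIsotropic σ (γ.map φ)) (hκ : 0 < κ)
    (hb : ∀ y, φ y ⬝ᵥ φ y ≤ 1) {i j : Fin m} {t : ℝ} (ht : |t| * κ ≤ 3 / 16)
    (s : Finset (Fin m)) (hi : i ∉ s) (hj : j ∉ s) :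
    ∫⁻ x, eexp (t * (∑ a ∈ s, gram φ x a i * gram φ x a j - s.card * (σ * gram φ x i j)))
      ∂(Measure.pi fun _ : Fin m => γ) ≤ eexp (s.card * (114 * (t * κ) ^ 2)) := by
  have := Measure.isProbabilityMeasure_map (μ := γ) hφ.aemeasurable
  induction s using Finset.induction_on with
  | empty => simp [eexp_zero]
  | insert a s ha ih =>
    have hia : i ≠ a := fun h => hi (by simp [h])
    have hja : j ≠ a := fun h => hj (by simp [h])
    rw [lintegral_pi_update γ (by fun_prop) a, Finset.card_insert_of_notMem ha]
    have h1 : ∀ (x : Fin m → E) (y : E), eexp (t * (∑ b ∈ insert a s,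
          gram φ (Function.update x a y) b i * gram φ (Function.update x a y) b j -
          ((s.card + 1 : ℕ) : ℝ) * (σ * gram φ (Function.update x a y) i j))) =
        eexp (t * (∑ b ∈ s, gram φ x b i * gram φ x b j - s.card * (σ * gram φ x i j)) -
          t * (σ * gram φ x i j)) * eexp (t * ((φ y ⬝ᵥ φ (x i)) * (φ y ⬝ᵥ φ (x j)))) := fun x y => by
      have e1 : ∑ b ∈ s, gram φ (Function.update x a y) b i * gram φ (Function.update x a y) b j
          = ∑ b ∈ s, gram φ x b i * gram φ x b j := Finset.sum_congr rfl fun b hb => by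
        have hba : b ≠ a := fun h => ha (h ▸ hb)
        rw [gram_update_of_ne φ x hba hia, gram_update_of_ne φ x hba hja]
      rw [Finset.sum_insert ha, e1, gram_update_of_ne φ x hia hja, gram_update_left φ x hia,
        gram_update_left φ x hja, ← eexp_add]
      congr 1; push_cast; ring
    simp_rw [h1]
    calc _ ≤ ∫⁻ x, eexp (114 * (t * κ) ^ 2) * eexp (t * (∑ b ∈ s, gram φ x b i * gram φ x b j -
            s.card * (σ * gram φ x i j))) ∂(Measure.pi fun _ : Fin m => γ) := by
          refine lintegral_mono fun x => ?_
          rw [lintegral_const_mul _ (by fun_prop)]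
          have := hν.lintegral_eexp_mul_mul hσ hκ one_pos (hb (x i)) (hb (x j)) (t := t)
            (by rwa [mul_one])
          rw [lintegral_map (by fun_prop) hφ] at this
          refine (mul_le_mul_right this _).trans ?_
          rw [← eexp_add, ← eexp_add]
          refine eexp_mono (le_of_eq ?_)
          rw [mul_one, gram]
          ring
      _ ≤ _ := by
          rw [lintegral_const_mul _ (by fun_prop)]
          refine (mul_le_mul_right (ih (fun h => hi (by simp [h]))
            (fun h => hj (by simp [h]))) _).trans ?_
          rw [← eexp_add]
          refine eexp_mono (le_of_eq ?_)
          push_cast; ring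

end Gram

/-! ### Truncated normalised Gaussian vectors -/

section Truncation

variable {d : ℕ}

/-- The law `N(0, I / d)`. -/
noncomputable def gaussianVector (d : ℕ) : Measure (Fin d → ℝ) :=
  Measure.pi fun _ => gaussianReal 0 ((d : ℝ≥0)⁻¹)

instance : IsProbabilityMeasure (gaussianVector d) := by unfold gaussianVector; infer_instance

/-- The normalisation of a vector, replaced by `0` when the norm is less than `1 / 2`. -/
noncomputable def truncNormalize (g : Fin d → ℝ) : Fin d → ℝ :=
  if 1 / 4 ≤ g ⬝ᵥ g then (√(g ⬝ᵥ g))⁻¹ • g else 0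

@[fun_prop]
theorem measurable_truncNormalize : Measurable (truncNormalize (d := d)) := by
  unfold truncNormalize
  refine Measurable.ite (measurableSet_le measurable_const (by fun_prop)) ?_ measurable_const
  have : Measurable fun g : Fin d → ℝ => (√(g ⬝ᵥ g))⁻¹ := by fun_prop
  exact this.smul measurable_id

theorem truncNormalize_dotProduct_self {g : Fin d → ℝ} (hg : 1 / 4 ≤ g ⬝ᵥ g) :
    truncNormalize g ⬝ᵥ truncNormalize g = 1 := by
  rw [truncNormalize, if_pos hg, smul_dotProduct, dotProduct_smul, smul_eq_mul, smul_eq_mul,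
    ← mul_assoc, ← mul_inv, Real.mul_self_sqrt (by linarith)]
  exact inv_mul_cancel₀ (by linarith)

theorem truncNormalize_dotProduct_self_le (g : Fin d → ℝ) :
    truncNormalize g ⬝ᵥ truncNormalize g ≤ 1 := by
  by_cases hg : 1 / 4 ≤ g ⬝ᵥ g
  · exact (truncNormalize_dotProduct_self hg).le
  · rw [truncNormalize, if_neg hg]; simp

theorem embedding_apply_eq_truncNormalize {m : ℕ} {g : Fin m → Fin d → ℝ} {i : Fin m}
    (hg : 1 / 4 ≤ g i ⬝ᵥ g i) : embedding g i = truncNormalize (g i) := by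
  have : ‖WithLp.toLp 2 (g i)‖ = √(g i ⬝ᵥ g i) := by
    rw [EuclideanSpace.norm_eq]
    simp [dotProduct, sq]
  rw [truncNormalize, if_pos hg, ← this]
  rfl

theorem abs_truncNormalize_dotProduct_le (g y : Fin d → ℝ) :
    |truncNormalize g ⬝ᵥ y| ≤ |2 * (g ⬝ᵥ y)| := by
  by_cases hg : 1 / 4 ≤ g ⬝ᵥ g
  · rw [truncNormalize, if_pos hg, smul_dotProduct, smul_eq_mul, abs_mul, abs_mul]
    gcongr
    refine inv_le_of_inv_le₀ (by norm_num) (Real.le_sqrt_of_sq_le (le_trans (by norm_num) hg))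
  · rw [truncNormalize, if_neg hg]; simp

/-- Multiplication of the coordinates by signs. -/
def flipSigns (ε : Fin d → ℝ) (g : Fin d → ℝ) : Fin d → ℝ := fun l => ε l * g l

theorem flipSigns_dotProduct_self {ε : Fin d → ℝ} (hε : ∀ l, ε l = 1 ∨ ε l = -1)
    (g : Fin d → ℝ) : flipSigns ε g ⬝ᵥ flipSigns ε g = g ⬝ᵥ g := by
  refine Finset.sum_congr rfl fun l _ => ?_
  rcases hε l with h | h <;> simp [flipSigns, h]

theorem truncNormalize_flipSigns {ε : Fin d → ℝ} (hε : ∀ l, ε l = 1 ∨ ε l = -1)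
    (g : Fin d → ℝ) : truncNormalize (flipSigns ε g) = flipSigns ε (truncNormalize g) := by
  unfold truncNormalize
  rw [flipSigns_dotProduct_self hε]
  split_ifs
  · ext l; simp [flipSigns]; ring
  · ext l; simp [flipSigns]

theorem measurePreserving_flipSigns {ε : Fin d → ℝ} (hε : ∀ l, ε l = 1 ∨ ε l = -1) :
    MeasurePreserving (flipSigns ε) (gaussianVector d) (gaussianVector d) := by
  refine measurePreserving_pi _ _ (f := fun l x => ε l * x) fun l => ⟨by fun_prop, ?_⟩
  rcases hε l with h | h
  · simp [h]
  · simpa [h] using gaussianReal_map_neg (μ := 0) (v := (d : ℝ≥0)⁻¹)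

theorem truncNormalize_comp_perm (τ : Equiv.Perm (Fin d)) (g : Fin d → ℝ) :
    truncNormalize (g ∘ τ) = truncNormalize g ∘ τ := by
  have : (g ∘ τ) ⬝ᵥ (g ∘ τ) = g ⬝ᵥ g := Equiv.sum_comp τ fun l => g l * g l
  unfold truncNormalize
  rw [this]
  split_ifs <;> rfl

theorem measurePreserving_comp_perm (τ : Equiv.Perm (Fin d)) :
    MeasurePreserving (fun g : Fin d → ℝ => g ∘ τ) (gaussianVector d) (gaussianVector d) := by
  refine ⟨by fun_prop, ?_⟩
  symm
  refine Measure.pi_eq fun s hs => ?_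
  rw [Measure.map_apply (by fun_prop) (.univ_pi hs)]
  have : (fun g : Fin d → ℝ => g ∘ τ) ⁻¹' Set.univ.pi s = Set.univ.pi fun l => s (τ.symm l) := by
    ext g
    simp only [Set.mem_preimage, Set.mem_pi, Set.mem_univ, true_implies, Function.comp]
    exact ⟨fun h l => by simpa using h (τ.symm l), fun h l => by simpa using h (τ l)⟩
  rw [this, gaussianVector, Measure.pi_pi]
  exact Equiv.prod_comp τ.symm fun l => gaussianReal 0 ((d : ℝ≥0)⁻¹) (s l)

theorem lintegral_eexp_gaussianVector (y : Fin d → ℝ) :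
    ∫⁻ g, eexp (g ⬝ᵥ y) ∂(gaussianVector d) = eexp ((d : ℝ)⁻¹ / 2 * (y ⬝ᵥ y)) := by
  simp_rw [dotProduct, eexp_sum]
  rw [gaussianVector, lintegral_pi_prod (f := fun l x => eexp (x * y l)) _ fun l => by fun_prop,
    Finset.mul_sum, eexp_sum]
  refine Finset.prod_congr rfl fun l _ => ?_
  simp_rw [mul_comm _ (y l)]
  rw [lintegral_eexp_mul_gaussianReal]
  congr 1
  push_cast; ring

theorem eexp_add_eexp_neg_le {s t : ℝ} (h : |s| ≤ |t|) :
    eexp s + eexp (-s) ≤ eexp t + eexp (-t) := by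
  unfold eexp
  rw [← ENNReal.ofReal_add (by positivity) (by positivity),
    ← ENNReal.ofReal_add (by positivity) (by positivity)]
  refine ENNReal.ofReal_le_ofReal ?_
  have := Real.cosh_le_cosh.2 h
  rw [Real.cosh_eq, Real.cosh_eq] at this
  linarith

/-- Symmetrisation under `g ↦ -g`: it turns an exponential moment into one of `cosh`, which depends
monotonically on the absolute value. -/
theorem two_mul_lintegral_eexp_of_neg {f : (Fin d → ℝ) → ℝ} (hf : Measurable f)
    (hneg : ∀ g, f (-g) = -f g) :
    2 * ∫⁻ g, eexp (f g) ∂(gaussianVector d) =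
      ∫⁻ g, (eexp (f g) + eexp (-f g)) ∂(gaussianVector d) := by
  rw [lintegral_add_left (by fun_prop), two_mul]
  congr 1
  have h := (measurePreserving_flipSigns (d := d) (ε := fun _ => -1) fun _ => Or.inr rfl)
  rw [← h.lintegral_comp (f := fun g => eexp (f g)) (by fun_prop)]
  refine lintegral_congr fun g => ?_
  rw [← hneg]
  congr 2
  ext l; simp [flipSigns]

/-- The truncated normalisation is odd, and its projections are at most twice those of `g` in
absolute value. After symmetrisation it is therefore dominated by `2 g`, whose variance proxy is `4
/ d`. -/
theorem isSubGaussian_truncNormalize :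
    IsSubGaussian (4 / d) ((gaussianVector d).map truncNormalize) := by
  intro y
  rw [lintegral_map (by fun_prop) (by fun_prop)]
  refine (ENNReal.mul_le_mul_iff_right (a := 2) (by simp) (by simp)).1 ?_
  have hneg : ∀ g : Fin d → ℝ, truncNormalize (-g) ⬝ᵥ y = -(truncNormalize g ⬝ᵥ y) := fun g => by
    have h := truncNormalize_flipSigns (ε := fun _ => -1) (fun _ => Or.inr rfl) g
    have e : ∀ g : Fin d → ℝ, flipSigns (fun _ => -1) g = -g := fun g => by
      ext l; simp [flipSigns]
    rw [e, e] at h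
    rw [h, neg_dotProduct]
  rw [two_mul_lintegral_eexp_of_neg (by fun_prop) hneg]
  calc _ ≤ ∫⁻ g, (eexp (2 * (g ⬝ᵥ y)) + eexp (-(2 * (g ⬝ᵥ y)))) ∂(gaussianVector d) :=
        lintegral_mono fun g => eexp_add_eexp_neg_le (abs_truncNormalize_dotProduct_le g y)
    _ = 2 * ∫⁻ g, eexp (2 * (g ⬝ᵥ y)) ∂(gaussianVector d) :=
        (two_mul_lintegral_eexp_of_neg (by fun_prop) fun g => by rw [neg_dotProduct]; ring).symm
    _ = _ := by
        have := lintegral_eexp_gaussianVector ((2 : ℝ) • y)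
        simp only [dotProduct_smul, smul_dotProduct, smul_eq_mul] at this
        rw [this]
        congr 2
        ring

theorem abs_truncNormalize_mul_le (g : Fin d → ℝ) (p q : Fin d) :
    |truncNormalize g p * truncNormalize g q| ≤ 1 := by
  have h : ∀ p, |truncNormalize g p| ≤ 1 := fun p => by
    rw [← sq_le_one_iff_abs_le_one]
    refine le_trans ?_ (truncNormalize_dotProduct_self_le g)
    rw [sq]
    exact Finset.single_le_sum (f := fun l => truncNormalize g l * truncNormalize g l)
      (fun l _ => mul_self_nonneg _) (Finset.mem_univ p)
  rw [abs_mul]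
  exact mul_le_one₀ (h p) (abs_nonneg _) (h q)

/-- Flipping the sign of one coordinate kills the mixed moments, swapping coordinates equates the
second moments, and the norm bound gives `d * σ ≤ 1`. -/
theorem exists_isIsotropic_truncNormalize (hd : 0 < d) :
    ∃ σ : ℝ, 0 ≤ σ ∧ d * σ ≤ 1 ∧ IsIsotropic σ ((gaussianVector d).map truncNormalize) := by
  have hm : ∀ p q : Fin d, Measurable fun g : Fin d → ℝ => truncNormalize g p * truncNormalize g q :=
    fun p q => ((measurable_pi_apply p).comp measurable_truncNormalize).mul
      ((measurable_pi_apply q).comp measurable_truncNormalize)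
  have hI : ∀ p q : Fin d,
      Integrable (fun g => truncNormalize g p * truncNormalize g q) (gaussianVector d) :=
    fun p q => Integrable.of_bound (hm p q).aestronglyMeasurable 1
      (ae_of_all _ fun g => abs_truncNormalize_mul_le g p q)
  have hmul : ∀ p q : Fin d, Measurable fun x : Fin d → ℝ => x p * x q := fun p q => by fun_prop
  set σ := ∫ g, truncNormalize g ⟨0, hd⟩ * truncNormalize g ⟨0, hd⟩ ∂(gaussianVector d) with hσ
  have hdiag : ∀ p, ∫ g, truncNormalize g p * truncNormalize g p ∂(gaussianVector d) = σ := by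
    intro p
    have h := measurePreserving_comp_perm (Equiv.swap p ⟨0, hd⟩)
    rw [hσ, ← h.map_eq, integral_map h.measurable.aemeasurable (hm _ _).aestronglyMeasurable,
      h.map_eq]
    refine integral_congr_ae (ae_of_all _ fun g => ?_)
    simp [truncNormalize_comp_perm]
  have hoff : ∀ p q : Fin d, p ≠ q →
      ∫ g, truncNormalize g p * truncNormalize g q ∂(gaussianVector d) = 0 := by
    intro p q hpq
    have hε : ∀ l, (fun l : Fin d => if l = p then (-1 : ℝ) else 1) l = 1 ∨
        (fun l : Fin d => if l = p then (-1 : ℝ) else 1) l = -1 := fun l => by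
      by_cases h : l = p <;> simp [h]
    have h := measurePreserving_flipSigns hε
    have e : ∫ g, truncNormalize g p * truncNormalize g q ∂(gaussianVector d) =
        -∫ g, truncNormalize g p * truncNormalize g q ∂(gaussianVector d) := by
      conv_lhs => rw [← h.map_eq]
      rw [integral_map h.measurable.aemeasurable (hm _ _).aestronglyMeasurable, ← integral_neg]
      refine integral_congr_ae (ae_of_all _ fun g => ?_)
      simp [truncNormalize_flipSigns hε, flipSigns, hpq.symm]
    linarith
  refine ⟨σ, integral_nonneg fun g => mul_self_nonneg _, ?_, fun p q => ⟨?_, ?_⟩⟩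
  · have : (d : ℝ) * σ = ∫ g, truncNormalize g ⬝ᵥ truncNormalize g ∂(gaussianVector d) := by
      simp_rw [dotProduct]
      rw [integral_finsetSum _ fun p _ => hI p p]
      simp [hdiag]
    rw [this]
    calc _ ≤ ∫ _ : Fin d → ℝ, (1 : ℝ) ∂(gaussianVector d) :=
          integral_mono (by simp_rw [dotProduct]; exact integrable_finsetSum _ fun p _ => hI p p)
            (integrable_const _) truncNormalize_dotProduct_self_le
      _ = 1 := by simp
  · rw [integrable_map_measure (hmul p q).aestronglyMeasurable (by fun_prop)]
    exact hI p q
  · rw [integral_map (by fun_prop) (hmul p q).aestronglyMeasurable]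
    split_ifs with h
    · rw [h]; exact hdiag q
    · exact hoff p q h

/-- Chernoff with exponent `-d * (g ⬝ᵥ g)`, whose exponential moment is `3^(-d/2)`; this is at most
`exp (-d/2)` because `e < 3`. -/
theorem gaussianVector_norm_lt (hd : 0 < d) :
    gaussianVector d {g | ¬ 1 / 4 ≤ g ⬝ᵥ g} ≤ eexp (-(d / 4)) := by
  have hd' : (0 : ℝ) < d := by exact_mod_cast hd
  have hv : ((d : ℝ≥0)⁻¹) ≠ 0 := inv_ne_zero (by exact_mod_cast hd.ne')
  have h1 : ∫⁻ g, eexp (-d * (g ⬝ᵥ g)) ∂(gaussianVector d) ≤ eexp (-(d / 2)) := by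
    have e : ∀ g : Fin d → ℝ, eexp (-d * (g ⬝ᵥ g)) =
        ∏ l, (fun x : ℝ => eexp (-1 * (x ^ 2 / ((d : ℝ≥0)⁻¹ : ℝ≥0)))) (g l) := fun g => by
      rw [dotProduct, Finset.mul_sum, eexp_sum]
      refine Finset.prod_congr rfl fun l _ => ?_
      simp only [NNReal.coe_inv, NNReal.coe_natCast, div_inv_eq_mul]
      congr 1; ring
    simp_rw [e]
    rw [gaussianVector, lintegral_pi_prod (f := fun _ x => eexp (-1 * (x ^ 2 / ((d : ℝ≥0)⁻¹ : ℝ≥0)))) _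
      fun l => by fun_prop]
    simp_rw [lintegral_eexp_sq_div_gaussianReal (show (-1 : ℝ) < 1 / 2 by norm_num) hv]
    rw [Finset.prod_const, Finset.card_univ, Fintype.card_fin]
    have e2 : ENNReal.ofReal (√(1 - 2 * -1))⁻¹ ≤ eexp (-(1 / 2)) := by
      refine ENNReal.ofReal_le_ofReal ?_
      rw [Real.exp_neg]
      refine inv_anti₀ (Real.exp_pos _) (Real.le_sqrt_of_sq_le ?_)
      rw [← Real.exp_nat_mul]
      have := Real.exp_one_lt_d9
      norm_num
      linarith
    calc _ ≤ eexp (-(1 / 2)) ^ d := by gcongr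
      _ = _ := by rw [eexp_nsmul]; congr 1; ring
  calc _ ≤ gaussianVector d {g | -(d / 4) ≤ -d * (g ⬝ᵥ g)} := measure_mono fun g hg => by
        simp only [Set.mem_ofPred_eq, not_le] at *
        nlinarith
    _ ≤ _ := measure_le_of_lintegral_eexp _ (by fun_prop) h1
    _ = _ := by congr 1; ring

end Truncation

/-! ### Typical Gram matrices -/

section Typical

variable {m d h : ℕ}

/-- The block `V_k`. -/
def block (b : Fin m → Fin h) (k : Fin h) : Finset (Fin m) := Finset.univ.filter fun a => b a = k

/-- The quasi-orthogonality properties of a Gram matrix `G` on which correctness of the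
construction rests. -/
structure IsTypical (π : Equiv.Perm (Fin m)) (b : Fin m → Fin h) (G : Fin m → Fin m → ℝ) :
    Prop where
  diag : ∀ a, G a a = 1
  off_diag : ∀ a c, a ≠ c → |G a c| ≤ 1 / 64
  sources : ∀ i k, ∑ a ∈ (block b k).erase i, G a i ^ 2 ≤ 32
  targets : ∀ j k, ∑ a ∈ (block (b ∘ π.symm) k).erase j, G a j ^ 2 ≤ 32
  forward : ∀ i j k, |∑ a ∈ (block (b ∘ π.symm) k).filter fun a => π.symm a < a ∧ a ≠ i ∧ a ≠ j,
    G (π.symm a) i * G a j| ≤ 1 / 32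
  backward : ∀ i j k, |∑ a ∈ (block b k).filter fun a => π a < a ∧ a ≠ i ∧ a ≠ j,
    G (π a) j * G a i| ≤ 1 / 32
  -- For `i = j` this would be a sum of up to `d` squares of order `1/d`, which need not be small.
  fixed : ∀ i j k, i ≠ j → |∑ a ∈ (block b k).filter fun a => π a = a ∧ a ≠ i ∧ a ≠ j,
    G a i * G a j| ≤ 1 / 32

theorem sum_sq_le_of_erase {G : Fin m → Fin m → ℝ} {i : Fin m} {s : Finset (Fin m)} {c : ℝ}
    (hd : G i i = 1) (hs : ∑ a ∈ s.erase i, G a i ^ 2 ≤ c) : ∑ a ∈ s, G a i ^ 2 ≤ c + 1 := by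
  by_cases h : i ∈ s
  · rw [← Finset.sum_erase_add s _ h, hd]; linarith
  · rw [Finset.erase_eq_of_notMem h] at hs; linarith

theorem card_block_comp_symm (π : Equiv.Perm (Fin m)) (b : Fin m → Fin h) (k : Fin h) :
    (block (b ∘ π.symm) k).card = (block b k).card := by
  have : block (b ∘ π.symm) k = (block b k).map π.toEmbedding := by
    ext a
    simp only [block, Finset.mem_filter, Finset.mem_univ, true_and, Function.comp, Finset.mem_map,
      Equiv.coe_toEmbedding]
    exact ⟨fun h => ⟨_, h, by simp⟩, by rintro ⟨c, h, rfl⟩; simpa using h⟩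
  rw [this, Finset.card_map]

/-- The law of the unnormalised embeddings, as a power of `N(0, I / d)`. -/
theorem gaussianLaw_eq_pi (m d : ℕ) :
    gaussianLaw m d = Measure.pi fun _ : Fin m => gaussianVector d := rfl

local notation "G" => gram truncNormalize

theorem gaussianLaw_norm (hd : 0 < d) (a : Fin m) :
    gaussianLaw m d {x | ¬ 1 / 4 ≤ x a ⬝ᵥ x a} ≤ eexp (-(d / 4)) := by
  have hs : MeasurableSet {g : Fin d → ℝ | ¬ 1 / 4 ≤ g ⬝ᵥ g} :=
    (measurableSet_le (f := fun _ => (1 / 4 : ℝ)) (g := fun g : Fin d → ℝ => g ⬝ᵥ g)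
      measurable_const (by fun_prop)).compl
  rw [gaussianLaw_eq_pi]
  exact ((measurePreserving_eval (fun _ : Fin m => gaussianVector d) a).measure_preimage
    hs.nullMeasurableSet).trans_le (gaussianVector_norm_lt hd)

theorem gaussianLaw_off_diag (hd : 0 < d) {a c : Fin m} (hac : a ≠ c) :
    gaussianLaw m d {x | 1 / 64 ≤ |G x a c|} ≤ 2 * eexp (-(d / 32768)) := by
  have hd' : (0 : ℝ) < d := by exact_mod_cast hd
  -- The value `l = d / 256` minimises the exponent `2 l² / d - l / 64`.
  have := measure_le_abs_and_le (gaussianLaw m d) (f := fun x => G x a c) (V := fun _ => 0)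
    (by fun_prop) (by fun_prop) (l := d / 256) (r := d / 32768) (c := 1 / 64) (v := 0)
    (by positivity) fun t ht => by
      simp only [sub_zero]
      refine (lintegral_eexp_gram isSubGaussian_truncNormalize (by fun_prop) (by positivity)
        truncNormalize_dotProduct_self_le hac t).trans (eexp_mono (le_of_eq ?_))
      rw [← sq_abs, ht]; field_simp; norm_num
  refine le_trans (measure_mono ?_) (this.trans_eq ?_)
  · exact fun x hx => ⟨hx, le_rfl⟩
  congr 2; ring

theorem gaussianLaw_sum_sq (hd : 0 < d) {i : Fin m} (T : Finset (Fin m)) (hi : i ∉ T)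
    (hT : T.card ≤ d) :
    gaussianLaw m d {x | 32 ≤ ∑ a ∈ T, G x a i ^ 2} ≤ eexp (-(2 * d)) := by
  have hd' : (0 : ℝ) < d := by exact_mod_cast hd
  -- `s = 3d/32` gives `s * (4/d) = 3/8`, the limit allowed; the level 32 then yields `exp (-3d)`
  -- against the factor `2 ^ T.card ≤ exp d`.
  have h1 := lintegral_eexp_sum_sq_gram (φ := truncNormalize) (γ := gaussianVector d)
    (s := 3 * d / 32) isSubGaussian_truncNormalize (by fun_prop) truncNormalize_dotProduct_self_le
    (by positivity) (by positivity) (by field_simp; norm_num) T hi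
  have h2 : (2 : ℝ≥0∞) ^ T.card ≤ eexp d := by
    have : (2 : ℝ≥0∞) ≤ eexp 1 := by
      rw [eexp, show (2 : ℝ≥0∞) = ENNReal.ofReal 2 by norm_num]
      refine ENNReal.ofReal_le_ofReal ?_
      have := Real.add_one_le_exp (1 : ℝ)
      linarith
    calc (2 : ℝ≥0∞) ^ T.card ≤ 2 ^ d := pow_le_pow_right₀ (by norm_num) hT
      _ ≤ eexp 1 ^ d := by gcongr
      _ = _ := by rw [eexp_nsmul, mul_one]
  calc _ ≤ gaussianLaw m d {x | 3 * d ≤ 3 * d / 32 * ∑ a ∈ T, G x a i ^ 2} :=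
        measure_mono fun x hx => by
          simp only [Set.mem_ofPred_eq] at *
          nlinarith
    _ ≤ _ := measure_le_of_lintegral_eexp _ (by fun_prop) (h1.trans h2)
    _ = _ := by congr 1; ring

theorem gaussianLaw_predecessor (hd : 0 < d) (i j : Fin m) (f : Fin m → Fin m)
    (s : Finset (Fin m)) (hs : ∀ a ∈ s, f a < a ∧ a ≠ i ∧ a ≠ j) :
    gaussianLaw m d {x | 1 / 32 ≤ |∑ a ∈ s, G x (f a) i * G x a j| ∧
      ∑ a ∈ s, G x (f a) i ^ 2 ≤ 33} ≤ 2 * eexp (-(d / 500000)) := by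
  have hd' : (0 : ℝ) < d := by exact_mod_cast hd
  -- With `l = d / 5000` the gain `l / 32` is more than twice the compensator `66 l² / d`.
  have := measure_le_abs_and_le (gaussianLaw m d) (f := fun x => ∑ a ∈ s, G x (f a) i * G x a j)
    (V := fun x => 4 / d / 2 * (d / 5000) ^ 2 * ∑ a ∈ s, G x (f a) i ^ 2)
    (by fun_prop) (by fun_prop) (l := d / 5000) (r := 0) (c := 1 / 32)
    (v := 4 / d / 2 * (d / 5000) ^ 2 * 33)
    (by positivity) fun t ht => by
      rw [eexp_zero, ← ht, sq_abs]
      exact lintegral_eexp_gram_mul_gram_predecessor isSubGaussian_truncNormalize (by fun_prop)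
        (by positivity) truncNormalize_dotProduct_self_le f t s (fun h => (hs i h).2.1 rfl)
        (fun h => (hs j h).2.2 rfl) fun a ha => (hs a ha).1
  refine le_trans (measure_mono ?_) (this.trans ?_)
  · exact fun x hx => ⟨hx.1, mul_le_mul_of_nonneg_left hx.2 (by positivity)⟩
  gcongr
  refine eexp_mono ?_
  have : 4 / (d : ℝ) / 2 * (d / 5000) ^ 2 * 33 = 66 / 25000000 * d := by field_simp; norm_num
  rw [this]; linarith

theorem gaussianLaw_fixed (hd : 0 < d) {σ : ℝ}
    (hσ : IsIsotropic σ ((gaussianVector d).map truncNormalize)) (i j : Fin m)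
    (s : Finset (Fin m)) (hcard : s.card ≤ d) (hi : i ∉ s) (hj : j ∉ s) :
    gaussianLaw m d {x | 1 / 64 ≤
      |∑ a ∈ s, G x a i * G x a j - s.card * (σ * G x i j)|} ≤ 2 * eexp (-(d / 50000000)) := by
  have hd' : (0 : ℝ) < d := by exact_mod_cast hd
  have hc : (s.card : ℝ) ≤ d := by exact_mod_cast hcard
  have := measure_le_abs_and_le (gaussianLaw m d)
    (f := fun x => ∑ a ∈ s, G x a i * G x a j - s.card * (σ * G x i j))
    (V := fun _ => 0)
    (by fun_prop) (by fun_prop) (l := d / 250000) (r := 1824 / 62500000000 * d) (c := 1 / 64)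
    (v := 0) (by positivity) fun t ht => by
      simp only [sub_zero]
      refine (lintegral_eexp_gram_mul_gram isSubGaussian_truncNormalize (by fun_prop) hσ
        (by positivity) truncNormalize_dotProduct_self_le (t := t) ?_ s hi hj).trans
        (eexp_mono ?_)
      · rw [ht]; field_simp; norm_num
      · have : (t * (4 / d)) ^ 2 = 16 / 62500000000 := by
          rw [mul_pow, ← sq_abs, ht]; field_simp; norm_num
        rw [this]; linarith
  refine le_trans (measure_mono ?_) (this.trans ?_)
  · exact fun x hx => ⟨hx, le_rfl⟩
  gcongr
  refine eexp_mono ?_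
  linarith

end Typical

/-! ### Rademacher vectors -/

section Signatures

theorem lintegral_rademacher (f : ℝ → ℝ≥0∞) :
    ∫⁻ x, f x ∂rademacher = 2⁻¹ * f 1 + 2⁻¹ * f (-1) := by
  simp [rademacher, lintegral_add_measure, lintegral_smul_measure]

theorem integrable_rademacher (f : ℝ → ℝ) : Integrable f rademacher := by
  unfold rademacher
  refine Integrable.add_measure ?_ ?_ <;>
  exact (integrable_dirac (by simp)).smul_measure (by simp)

theorem integral_rademacher (f : ℝ → ℝ) : ∫ x, f x ∂rademacher = 2⁻¹ * f 1 + 2⁻¹ * f (-1) := by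
  have h : ∀ a : ℝ, Integrable f ((2⁻¹ : ℝ≥0∞) • Measure.dirac a) := fun a =>
    (integrable_dirac (by simp)).smul_measure (by simp)
  rw [rademacher, integral_add_measure (h _) (h _)]
  simp [integral_smul_measure]

theorem lintegral_eexp_mul_rademacher (t : ℝ) :
    ∫⁻ x, eexp (x * t) ∂rademacher ≤ eexp (t ^ 2 / 2) := by
  rw [lintegral_rademacher]
  have h2 : (2⁻¹ : ℝ≥0∞) = ENNReal.ofReal 2⁻¹ := by
    rw [ENNReal.ofReal_inv_of_pos (by norm_num)]; norm_num
  simp only [eexp]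
  rw [h2, ← ENNReal.ofReal_mul (by norm_num), ← ENNReal.ofReal_mul (by norm_num),
    ← ENNReal.ofReal_add (by positivity) (by positivity)]
  refine ENNReal.ofReal_le_ofReal (le_trans (le_of_eq ?_) (Real.cosh_le_exp_half_sq t))
  rw [Real.cosh_eq, one_mul, neg_one_mul]; ring

variable {n : Type*} [Fintype n]

theorem isSubGaussian_rademacher : IsSubGaussian 1 (Measure.pi fun _ : n => rademacher) := by
  intro y
  simp_rw [dotProduct, eexp_sum]
  rw [lintegral_pi_prod (f := fun l x => eexp (x * y l)) _ fun l => by fun_prop,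
    Finset.mul_sum, eexp_sum]
  refine Finset.prod_le_prod' fun l _ => (lintegral_eexp_mul_rademacher (y l)).trans ?_
  exact eexp_mono (le_of_eq (by ring))

theorem isIsotropic_rademacher [DecidableEq n] :
    IsIsotropic 1 (Measure.pi fun _ : n => rademacher) := by
  intro p q
  have hev : ∀ l : n, MeasurePreserving (fun x : n → ℝ => x l) (Measure.pi fun _ => rademacher)
      rademacher := fun l => measurePreserving_eval (fun _ => rademacher) l
  by_cases h : p = q
  · subst h
    rw [if_pos rfl]
    have hm : AEStronglyMeasurable (fun x : ℝ => x * x)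
        ((Measure.pi fun _ : n => rademacher).map fun x => x p) := by fun_prop
    refine ⟨(hev p).integrable_comp_of_integrable (integrable_rademacher fun x => x * x), ?_⟩
    have := integral_map (hev p).measurable.aemeasurable hm
    rw [(hev p).map_eq, integral_rademacher] at this
    rw [← this]; norm_num
  · rw [if_neg h]
    have hind := (iIndepFun_pi (μ := fun _ : n => rademacher) (X := fun _ (x : ℝ) => x)
      fun _ => aemeasurable_id).indepFun h
    have hI : ∀ l : n, Integrable (fun x : n → ℝ => x l) (Measure.pi fun _ => rademacher) :=
      fun l => (hev l).integrable_comp_of_integrable (integrable_rademacher fun x => x)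
    refine ⟨hind.integrable_mul (hI p) (hI q), ?_⟩
    have h0 : ∫ x : n → ℝ, x p ∂(Measure.pi fun _ => rademacher) = 0 := by
      have := integral_map (μ := Measure.pi fun _ : n => rademacher)
        (f := fun x : ℝ => x) (hev p).measurable.aemeasurable (by fun_prop)
      rw [(hev p).map_eq, integral_rademacher] at this
      rw [← this]; norm_num
    have := hind.integral_mul_eq_mul_integral (hI p).1 (hI q).1
    rw [h0, zero_mul] at this
    exact this

/-- The scores concentrate around `dk` times the inner product of the coefficient vectors. -/
theorem signatureLaw_deviation {m dk : ℕ} {u v : Fin m → ℝ} (hu : u ⬝ᵥ u ≤ 33)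
    (hv : v ⬝ᵥ v ≤ 33) :
    signatureLaw m dk {W | (dk : ℝ) / 8 ≤
      |∑ l, ((fun a => W a l) ⬝ᵥ u) * ((fun a => W a l) ⬝ᵥ v) - dk * (u ⬝ᵥ v)|} ≤ 2 * eexp (-(dk / 50000000)) := by
  have hT : Measurable fun (W : Fin m → Fin dk → ℝ) (l : Fin dk) (a : Fin m) => W a l := by fun_prop
  have hWl : ∀ l : Fin dk, Measurable fun W : Fin m → Fin dk → ℝ => fun a => W a l := fun l =>
    (measurable_pi_apply l).comp hT
  have hf : Measurable fun W : Fin m → Fin dk → ℝ =>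
      ∑ l, ((fun a => W a l) ⬝ᵥ u) * ((fun a => W a l) ⬝ᵥ v) - dk * (u ⬝ᵥ v) := by fun_prop
  have := measure_le_abs_and_le (signatureLaw m dk) (V := fun _ => 0) hf
    (by fun_prop) (l := 1 / 2000000) (r := dk * (124146 / 4000000000000)) (c := dk / 8) (v := 0)
    (by positivity) fun t ht => by
      simp only [sub_zero]
      have hswap := map_pi_swap (ι := Fin m) (κ := Fin dk) rademacher
      let F : (Fin dk → Fin m → ℝ) → ℝ≥0∞ := fun c =>
        ∏ l, eexp (-(t * (u ⬝ᵥ v))) * eexp (t * ((c l ⬝ᵥ u) * (c l ⬝ᵥ v)))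
      have hF : F = fun c =>
        ∏ l, eexp (-(t * (u ⬝ᵥ v))) * eexp (t * ((c l ⬝ᵥ u) * (c l ⬝ᵥ v))) := rfl
      have hFm : Measurable F := by rw [hF]; fun_prop
      have h1 : ∀ W : Fin m → Fin dk → ℝ,
          eexp (t * (∑ l, ((fun a => W a l) ⬝ᵥ u) * ((fun a => W a l) ⬝ᵥ v) - dk * (u ⬝ᵥ v))) =
          F fun l a => W a l := fun W => by
        simp only [hF, ← eexp_add, ← eexp_sum]
        congr 1
        rw [Finset.sum_add_distrib, ← Finset.mul_sum]
        simp only [Finset.sum_const, Finset.card_univ, Fintype.card_fin, nsmul_eq_mul]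
        ring
      rw [lintegral_congr h1, signatureLaw, ← lintegral_map hFm hT]
      rw [hswap, hF, lintegral_pi_prod (f := fun _ y => eexp (-(t * (u ⬝ᵥ v))) *
        eexp (t * ((y ⬝ᵥ u) * (y ⬝ᵥ v)))) _ fun l => by fun_prop]
      simp only [Finset.prod_const, Finset.card_univ, Fintype.card_fin]
      rw [← eexp_nsmul]
      gcongr
      rw [lintegral_const_mul _ (by fun_prop)]
      refine (mul_le_mul_right (isSubGaussian_rademacher.lintegral_eexp_mul_mul
        isIsotropic_rademacher one_pos (by norm_num : (0 : ℝ) < 33) hu hv (t := t) ?_) _).trans ?_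
      · rw [ht]; norm_num
      · rw [← eexp_add]
        refine eexp_mono (le_of_eq ?_)
        rw [mul_pow t, ← sq_abs t, ht]
        ring
  refine le_trans (measure_mono ?_) (this.trans ?_)
  · exact fun x hx => ⟨hx, le_rfl⟩
  gcongr
  refine eexp_mono ?_
  have : (0 : ℝ) ≤ dk := Nat.cast_nonneg _
  linarith

end Signatures

/-! ### Union bound over the exceptional events of the embeddings -/

section Union

variable {m d h : ℕ}

local notation "G" => gram truncNormalize

theorem gaussianLaw_not_typical (hd : 0 < d) (hh : 0 < h) (π : Equiv.Perm (Fin m))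
    (b : Fin m → Fin h) (hb : ∀ k, (block b k).card = d) :
    gaussianLaw m d {x | ¬ (IsTypical π b (G x) ∧ ∀ a, 1 / 4 ≤ x a ⬝ᵥ x a)} ≤
      (m * (m * h) : ℕ) * (14 * eexp (-(d / 50000000))) := by
  obtain ⟨σ, hσ0, hσ1, hσ⟩ := exists_isIsotropic_truncNormalize hd
  have hd' : (0 : ℝ) < d := by exact_mod_cast hd
  set ε : ℝ≥0∞ := 2 * eexp (-(d / 50000000)) with hε
  have hle : ∀ t : ℝ, t ≤ -(d / 50000000) → 2 * eexp t ≤ ε := fun t ht => by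
    rw [hε]; gcongr; exact eexp_mono ht
  have hle1 : ∀ t : ℝ, t ≤ -(d / 50000000) → eexp t ≤ ε := fun t ht =>
    le_trans (le_mul_of_one_le_left zero_le (by norm_num)) (hle t ht)
  let s (i : Fin m) (k : Fin h) := (block b k).erase i
  let s' (j : Fin m) (k : Fin h) := (block (b ∘ π.symm) k).erase j
  let f (i j : Fin m) (k : Fin h) :=
    (block (b ∘ π.symm) k).filter fun a => π.symm a < a ∧ a ≠ i ∧ a ≠ j
  let r (i j : Fin m) (k : Fin h) := (block b k).filter fun a => π a < a ∧ a ≠ i ∧ a ≠ j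
  let p (i j : Fin m) (k : Fin h) := (block b k).filter fun a => π a = a ∧ a ≠ i ∧ a ≠ j
  -- Seven events per triple, each of probability at most `ε`, account for the factor 14. The two
  -- martingale events carry the bound 33 on the compensator, which holds once the other events are
  -- excluded.
  let bad (i j : Fin m) (k : Fin h) : Fin 7 → Set (Fin m → Fin d → ℝ) :=
    ![{x | ¬ 1 / 4 ≤ x i ⬝ᵥ x i},
      {x | i ≠ j ∧ 1 / 64 ≤ |G x i j|},
      {x | 32 ≤ ∑ a ∈ s i k, G x a i ^ 2},
      {x | 32 ≤ ∑ a ∈ s' j k, G x a j ^ 2},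
      {x | 1 / 32 ≤ |∑ a ∈ f i j k, G x (π.symm a) i * G x a j| ∧
        ∑ a ∈ f i j k, G x (π.symm a) i ^ 2 ≤ 33},
      {x | 1 / 32 ≤ |∑ a ∈ r i j k, G x (π a) j * G x a i| ∧
        ∑ a ∈ r i j k, G x (π a) j ^ 2 ≤ 33},
      {x | 1 / 64 ≤ |∑ a ∈ p i j k, G x a i * G x a j - (p i j k).card * (σ * G x i j)|}]
  have hbad : ∀ i j k e, gaussianLaw m d (bad i j k e) ≤ ε := by
    intro i j k e
    have hcs : ∀ (b' : Fin m → Fin h) (i : Fin m), (block b' k).card = d →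
        ((block b' k).erase i).card ≤ d := fun b' i hb' => hb' ▸ Finset.card_erase_le
    fin_cases e
    · exact (gaussianLaw_norm hd i).trans (hle1 _ (by linarith))
    · by_cases hij : i = j
      · simp [bad, hij]
      · refine le_trans (measure_mono ?_) ((gaussianLaw_off_diag hd hij).trans (hle _ (by linarith)))
        exact fun x hx => hx.2
    · exact (gaussianLaw_sum_sq hd _ (Finset.notMem_erase i _) (hcs b i (hb k))).trans
        (hle1 _ (by linarith))
    · exact (gaussianLaw_sum_sq hd _ (Finset.notMem_erase j _)
        (hcs _ j ((card_block_comp_symm π b k).trans (hb k)))).trans (hle1 _ (by linarith))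
    · exact (gaussianLaw_predecessor hd i j π.symm _ fun a ha =>
        (Finset.mem_filter.1 ha).2).trans (hle _ (by linarith))
    · exact (gaussianLaw_predecessor hd j i π _ fun a ha =>
        ⟨(Finset.mem_filter.1 ha).2.1, (Finset.mem_filter.1 ha).2.2.2,
          (Finset.mem_filter.1 ha).2.2.1⟩).trans (hle _ (by linarith))
    · exact (gaussianLaw_fixed hd hσ i j _
        ((Finset.card_le_card (Finset.filter_subset _ _)).trans (hb k).le)
        (fun hi => (Finset.mem_filter.1 hi).2.2.1 rfl)
        (fun hj => (Finset.mem_filter.1 hj).2.2.2 rfl)).trans (hle _ (by linarith))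
  have hsub : {x | ¬ (IsTypical π b (G x) ∧ ∀ a, 1 / 4 ≤ x a ⬝ᵥ x a)} ⊆
      {x | ∃ q : Fin m × Fin m × Fin h, ∃ e, x ∈ bad q.1 q.2.1 q.2.2 e} := by
    intro x hx
    by_contra hcon
    refine hx ?_
    have hno : ∀ i j k e, x ∉ bad i j k e := fun i j k e hmem => hcon ⟨(i, j, k), e, hmem⟩
    have k₀ : Fin h := ⟨0, hh⟩
    have h0 : ∀ i, 1 / 4 ≤ x i ⬝ᵥ x i := fun i => not_not.1 (hno i i k₀ 0)
    have h1 : ∀ i j, i ≠ j → |G x i j| < 1 / 64 := fun i j hij =>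
      not_le.1 fun hc => hno i j k₀ 1 ⟨hij, hc⟩
    have h2 : ∀ i k, ∑ a ∈ s i k, G x a i ^ 2 < 32 := fun i k => not_le.1 (hno i i k 2)
    have h3 : ∀ j k, ∑ a ∈ s' j k, G x a j ^ 2 < 32 := fun j k => not_le.1 (hno j j k 3)
    have hdiag : ∀ a, G x a a = 1 := fun a => truncNormalize_dotProduct_self (h0 a)
    -- The extra 1 is the possible diagonal term: in the sums below the image of `a` under `π` or
    -- `π.symm` may be the fixed index itself.
    have hbl : ∀ (j : Fin m) (k : Fin h), ∑ a ∈ block b k, G x a j ^ 2 ≤ 33 := fun j k =>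
      (sum_sq_le_of_erase (hdiag j) (h2 j k).le).trans (by norm_num)
    have hbl' : ∀ (j : Fin m) (k : Fin h), ∑ a ∈ block (b ∘ π.symm) k, G x a j ^ 2 ≤ 33 := fun j k =>
      (sum_sq_le_of_erase (hdiag j) (h3 j k).le).trans (by norm_num)
    refine ⟨⟨hdiag, fun a c hac => (h1 a c hac).le, fun i k => (h2 i k).le, fun j k => (h3 j k).le,
      fun i j k => ?_, fun i j k => ?_, fun i j k hij => ?_⟩, h0⟩
    · refine (not_le.1 fun hc => hno i j k 4 ⟨hc, ?_⟩).le
      refine le_trans ?_ (hbl i k)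
      calc _ ≤ ∑ a ∈ block (b ∘ π.symm) k, G x (π.symm a) i ^ 2 :=
            Finset.sum_le_sum_of_subset_of_nonneg (Finset.filter_subset _ _)
              fun _ _ _ => sq_nonneg _
        _ = _ := by
            simp only [block, Finset.sum_filter, Function.comp]
            exact Equiv.sum_comp π.symm fun a => if b a = k then G x a i ^ 2 else 0
    · refine (not_le.1 fun hc => hno i j k 5 ⟨hc, ?_⟩).le
      refine le_trans ?_ (hbl' j k)
      calc _ ≤ ∑ a ∈ block b k, G x (π a) j ^ 2 :=
            Finset.sum_le_sum_of_subset_of_nonneg (Finset.filter_subset _ _)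
              fun _ _ _ => sq_nonneg _
        _ = _ := by
            simp only [block, Finset.sum_filter, Function.comp]
            rw [← Equiv.sum_comp π fun a => if b (π.symm a) = k then G x a j ^ 2 else 0]
            simp
    · have h6 : |∑ a ∈ p i j k, G x a i * G x a j - (p i j k).card * (σ * G x i j)| < 1 / 64 :=
        not_le.1 (hno i j k 6)
      have hcard : ((p i j k).card : ℝ) * σ ≤ 1 := by
        refine le_trans ?_ hσ1
        gcongr
        exact (Finset.card_le_card (Finset.filter_subset _ _)).trans (hb k).le
      -- The conditional mean is small because a block has only `d` elements and `d * σ ≤ 1`.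
      have h7 : |((p i j k).card : ℝ) * (σ * G x i j)| ≤ 1 / 64 := by
        rw [← mul_assoc, abs_mul, abs_of_nonneg (by positivity)]
        exact (mul_le_of_le_one_left (abs_nonneg _) hcard).trans (h1 i j hij).le
      have := abs_add_le (∑ a ∈ p i j k, G x a i * G x a j - (p i j k).card * (σ * G x i j))
        ((p i j k).card * (σ * G x i j))
      rw [sub_add_cancel] at this
      exact this.trans (by linarith)
  calc _ ≤ _ := measure_mono hsub
    _ ≤ Fintype.card (Fin m × Fin m × Fin h) * (Fintype.card (Fin 7) * ε) :=
        measure_exists_le _ fun q => measure_exists_le _ fun e => hbad _ _ _ e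
    _ = _ := by
        rw [hε, ← mul_assoc (Fintype.card (Fin 7) : ℝ≥0∞)]
        simp only [Fintype.card_prod, Fintype.card_fin]
        norm_num

end Union

/-! ### Deterministic analysis of the scores -/

section Deterministic

variable {m d dk h : ℕ}

/-- The coefficients of the signatures in the query of a source. -/
def queryCoeff (π : Equiv.Perm (Fin m)) (b : Fin m → Fin h) (G : Fin m → Fin m → ℝ) (k : Fin h)
    (i : Fin m) : Fin m → ℝ := fun c => if b (π.symm c) = k then G (π.symm c) i else 0

/-- The coefficients of the signatures in the key of a target. -/
def keyCoeff (π : Equiv.Perm (Fin m)) (b : Fin m → Fin h) (G : Fin m → Fin m → ℝ) (k : Fin h)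
    (j : Fin m) : Fin m → ℝ := fun c => if b (π.symm c) = k then G c j else 0

/-- The mean of a score over the signatures, divided by the width of the head. -/
def meanScore (π : Equiv.Perm (Fin m)) (b : Fin m → Fin h) (G : Fin m → Fin m → ℝ) (k : Fin h)
    (i j : Fin m) : ℝ := ∑ a ∈ block b k, G a i * G (π a) j

theorem sum_block_comp_symm (π : Equiv.Perm (Fin m)) (b : Fin m → Fin h) (k : Fin h)
    (f : Fin m → ℝ) :
    ∑ c, (if b (π.symm c) = k then f c else 0) = ∑ a ∈ block b k, f (π a) := by
  rw [block, Finset.sum_filter, ← Equiv.sum_comp π]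
  simp

/-- The product `X i ᵥ* Xᵀ` is a row of the Gram matrix, so each factor is a linear form in a column
of `W`. The query sum is reindexed by `π`, so that both coefficient vectors are indexed by the
signatures. -/
theorem headScore_eq (π : Equiv.Perm (Fin m)) (b : Fin m → Fin h) (X : Matrix (Fin m) (Fin d) ℝ)
    (W : Fin m → Fin dk → ℝ) (k : Fin h) (i j : Fin m) :
    headScore π b X W k i j =
      ∑ l, ((fun a => W a l) ⬝ᵥ queryCoeff π b (fun a c => X a ⬝ᵥ X c) k i) *
        ((fun a => W a l) ⬝ᵥ keyCoeff π b (fun a c => X a ⬝ᵥ X c) k j) := by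
  have hX : ∀ i, X i ᵥ* Xᵀ = fun a => X a ⬝ᵥ X i := fun i => by
    ext a; rw [vecMul_transpose, mulVec]
  unfold headScore queryWeights keyWeights
  rw [← vecMul_vecMul, ← vecMul_vecMul, hX, hX, dotProduct]
  refine Finset.sum_congr rfl fun l _ => ?_
  congr 1
  · simp only [vecMul, dotProduct, queryTemplate, queryCoeff, of_apply]
    rw [← Equiv.sum_comp π.symm]
    refine Finset.sum_congr rfl fun c _ => ?_
    split_ifs <;> simp [mul_comm]
  · simp only [vecMul, dotProduct, keyTemplate, keyCoeff, of_apply]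
    refine Finset.sum_congr rfl fun c _ => ?_
    split_ifs <;> simp [mul_comm]

variable {π : Equiv.Perm (Fin m)} {b : Fin m → Fin h} {G : Fin m → Fin m → ℝ}

theorem queryCoeff_dotProduct_keyCoeff (k : Fin h) (i j : Fin m) :
    queryCoeff π b G k i ⬝ᵥ keyCoeff π b G k j = meanScore π b G k i j := by
  have := sum_block_comp_symm π b k fun c => G (π.symm c) i * G c j
  simp only [Equiv.symm_apply_apply] at this
  rw [meanScore, ← this, dotProduct]
  refine Finset.sum_congr rfl fun c _ => ?_
  simp only [queryCoeff, keyCoeff]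
  split_ifs <;> simp

theorem IsTypical.queryCoeff_le (hG : IsTypical π b G) (k : Fin h) (i : Fin m) :
    queryCoeff π b G k i ⬝ᵥ queryCoeff π b G k i ≤ 33 := by
  have := sum_block_comp_symm π b k fun c => G (π.symm c) i ^ 2
  simp only [Equiv.symm_apply_apply] at this
  calc _ = ∑ a ∈ block b k, G a i ^ 2 := by
        rw [← this, dotProduct]
        refine Finset.sum_congr rfl fun c _ => ?_
        simp only [queryCoeff]
        split_ifs <;> simp [sq]
    _ ≤ 32 + 1 := sum_sq_le_of_erase (hG.diag i) (hG.sources i k)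
    _ = 33 := by norm_num

theorem IsTypical.keyCoeff_le (hG : IsTypical π b G) (k : Fin h) (j : Fin m) :
    keyCoeff π b G k j ⬝ᵥ keyCoeff π b G k j ≤ 33 := by
  calc _ = ∑ a ∈ block (b ∘ π.symm) k, G a j ^ 2 := by
        rw [block, Finset.sum_filter, dotProduct]
        refine Finset.sum_congr rfl fun c _ => ?_
        simp only [keyCoeff, Function.comp]
        split_ifs <;> simp [sq]
    _ ≤ 32 + 1 := sum_sq_le_of_erase (hG.diag j) (hG.targets j k)
    _ = 33 := by norm_num

theorem IsTypical.abs_le_one (hG : IsTypical π b G) (a c : Fin m) : |G a c| ≤ 1 := by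
  by_cases h : a = c
  · rw [h, hG.diag, abs_one]
  · exact (hG.off_diag a c h).trans (by norm_num)

theorem IsTypical.abs_mul_le (hG : IsTypical π b G) {i j a : Fin m} (h : ¬(a = i ∧ π a = j)) :
    |G a i * G (π a) j| ≤ 1 / 64 := by
  rw [abs_mul]
  by_cases h1 : a = i
  · exact (mul_le_of_le_one_left (abs_nonneg _) (hG.abs_le_one _ _)).trans
      (hG.off_diag _ _ fun h2 => h ⟨h1, h2⟩)
  · exact (mul_le_of_le_one_right (abs_nonneg _) (hG.abs_le_one _ _)).trans (hG.off_diag _ _ h1)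

/-- The elements of a block whose edges touch `i` or `j`. -/
def touching (π : Equiv.Perm (Fin m)) (b : Fin m → Fin h) (k : Fin h) (i j : Fin m) :
    Finset (Fin m) :=
  (block b k).filter fun a => ¬(π a = a ∧ a ≠ i ∧ a ≠ j) ∧ ¬(a < π a ∧ π a ≠ i ∧ π a ≠ j) ∧
    ¬(π a < a ∧ a ≠ i ∧ a ≠ j)

/-- By trichotomy for `π a` and `a`, failing all three conditions forces `a` or `π a` to be `i` or
`j`. -/
theorem card_touching_le (k : Fin h) (i j : Fin m) : (touching π b k i j).card ≤ 4 := by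
  have : touching π b k i j ⊆ {i, j, π.symm i, π.symm j} := by
    intro a ha
    have h := (Finset.mem_filter.1 ha).2
    simp only [Finset.mem_insert, Finset.mem_singleton, Equiv.eq_symm_apply]
    rcases lt_trichotomy (π a) a with h1 | h1 | h1 <;> tauto
  exact (Finset.card_le_card this).trans Finset.card_le_four

/-- The increasing and decreasing edges contribute at most 1/32 each. The fixed points are kept
apart because their sum is controlled differently for edges and non-edges. -/
theorem IsTypical.abs_meanScore_sub_le (hG : IsTypical π b G) (k : Fin h) (i j : Fin m) :
    |meanScore π b G k i j - (∑ a ∈ touching π b k i j, G a i * G (π a) j +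
      ∑ a ∈ (block b k).filter fun a => π a = a ∧ a ≠ i ∧ a ≠ j, G a i * G a j)| ≤ 1 / 16 := by
  have hsplit : meanScore π b G k i j =
      (∑ a ∈ (block b k).filter fun a => π a = a ∧ a ≠ i ∧ a ≠ j, G a i * G (π a) j) +
      (∑ a ∈ (block b k).filter fun a => a < π a ∧ π a ≠ i ∧ π a ≠ j, G a i * G (π a) j) +
      (∑ a ∈ (block b k).filter fun a => π a < a ∧ a ≠ i ∧ a ≠ j, G a i * G (π a) j) +
      ∑ a ∈ touching π b k i j, G a i * G (π a) j := by
    simp only [meanScore, touching, Finset.sum_filter (s := block b k), ← Finset.sum_add_distrib]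
    refine Finset.sum_congr rfl fun a _ => ?_
    rcases lt_trichotomy (π a) a with h1 | h1 | h1
    · have h2 : ¬ a < π a := h1.asymm
      have h3 : π a ≠ a := h1.ne
      by_cases h4 : a ≠ i ∧ a ≠ j <;> simp [h1, h2, h3, h4]
    · have h2 : ¬ a < π a := h1.not_gt
      have h3 : ¬ π a < a := h1.not_lt
      by_cases h4 : a ≠ i ∧ a ≠ j <;> simp [h1, h4]
    · have h2 : ¬ π a < a := h1.asymm
      have h3 : π a ≠ a := h1.ne'
      by_cases h4 : π a ≠ i ∧ π a ≠ j <;> simp [h1, h2, h3, h4]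
  have hfix : (∑ a ∈ (block b k).filter fun a => π a = a ∧ a ≠ i ∧ a ≠ j, G a i * G (π a) j) =
      ∑ a ∈ (block b k).filter fun a => π a = a ∧ a ≠ i ∧ a ≠ j, G a i * G a j :=
    Finset.sum_congr rfl fun a ha => by rw [(Finset.mem_filter.1 ha).2.1]
  have hfwd : (∑ a ∈ (block b k).filter fun a => a < π a ∧ π a ≠ i ∧ π a ≠ j, G a i * G (π a) j) =
      ∑ a ∈ (block (b ∘ π.symm) k).filter fun a => π.symm a < a ∧ a ≠ i ∧ a ≠ j,
        G (π.symm a) i * G a j := by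
    have := sum_block_comp_symm π b k fun c =>
      if π.symm c < c ∧ c ≠ i ∧ c ≠ j then G (π.symm c) i * G c j else 0
    simp only [Equiv.symm_apply_apply] at this
    rw [Finset.sum_filter, ← this, Finset.sum_filter, block, Finset.sum_filter]
    rfl
  have hbwd : (∑ a ∈ (block b k).filter fun a => π a < a ∧ a ≠ i ∧ a ≠ j, G a i * G (π a) j) =
      ∑ a ∈ (block b k).filter fun a => π a < a ∧ a ≠ i ∧ a ≠ j, G (π a) j * G a i :=
    Finset.sum_congr rfl fun a _ => mul_comm _ _
  have h1 := abs_le.1 (hG.forward i j k)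
  have h2 := abs_le.1 (hG.backward i j k)
  rw [hsplit, hfix, hfwd, hbwd, abs_le]
  constructor <;> linarith

/-- No term is the edge from `i` to `j`, so the four exceptional terms are at most 1/64 each; the
total is `1/16 + 1/32 + 1/16`. The sum over fixed points is small if `i ≠ j` and empty if there are
no self-loops. -/
theorem IsTypical.abs_meanScore_le (hG : IsTypical π b G) {k : Fin h} {i j : Fin m}
    (hj : j ≠ π i) (hij : i ≠ j ∨ ∀ a, π a ≠ a) : |meanScore π b G k i j| ≤ 1 / 4 := by
  have h1 : |∑ a ∈ touching π b k i j, G a i * G (π a) j| ≤ 1 / 16 := by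
    calc _ ≤ ∑ a ∈ touching π b k i j, |G a i * G (π a) j| := Finset.abs_sum_le_sum_abs _ _
      _ ≤ (touching π b k i j).card • (1 / 64 : ℝ) :=
          Finset.sum_le_card_nsmul _ _ _ fun a _ => hG.abs_mul_le fun h => hj (by rw [← h.1, h.2])
      _ ≤ 4 • (1 / 64 : ℝ) := by gcongr; exact card_touching_le k i j
      _ = 1 / 16 := by norm_num
  have h2 : |∑ a ∈ (block b k).filter fun a => π a = a ∧ a ≠ i ∧ a ≠ j, G a i * G a j| ≤ 1 / 32 := by
    rcases hij with hij | hπ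
    · exact hG.fixed i j k hij
    · simp [hπ]
  have h3 := abs_le.1 (hG.abs_meanScore_sub_le k i j)
  have h1 := abs_le.1 h1
  have h2 := abs_le.1 h2
  rw [abs_le]
  constructor <;> linarith

/-- The term `a = i` equals 1 and everything else is at least `-(1/16 + 1/32 + 1/16)`. If `i` is
itself a fixed point, the fixed-point sum consists of squares, so its sign suffices. -/
theorem IsTypical.le_meanScore (hG : IsTypical π b G) (i : Fin m) :
    3 / 4 ≤ meanScore π b G (b i) i (π i) := by
  have hi : i ∈ touching π b (b i) i (π i) := by
    simp [touching, block]
  have h1 : 1 - 1 / 16 ≤ ∑ a ∈ touching π b (b i) i (π i), G a i * G (π a) (π i) := by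
    rw [← Finset.add_sum_erase _ _ hi, hG.diag, hG.diag]
    have : |∑ a ∈ (touching π b (b i) i (π i)).erase i, G a i * G (π a) (π i)| ≤ 1 / 16 := by
      calc _ ≤ ∑ a ∈ (touching π b (b i) i (π i)).erase i, |G a i * G (π a) (π i)| :=
            Finset.abs_sum_le_sum_abs _ _
        _ ≤ ((touching π b (b i) i (π i)).erase i).card • (1 / 64 : ℝ) :=
            Finset.sum_le_card_nsmul _ _ _ fun a ha =>
              hG.abs_mul_le fun h => (Finset.ne_of_mem_erase ha) h.1
        _ ≤ 4 • (1 / 64 : ℝ) := by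
            gcongr
            exact Finset.card_erase_le.trans (card_touching_le (b i) i (π i))
        _ = 1 / 16 := by norm_num
    linarith [(abs_le.1 this).1]
  have h2 : -(1 / 32) ≤ ∑ a ∈ (block b (b i)).filter fun a => π a = a ∧ a ≠ i ∧ a ≠ π i,
      G a i * G a (π i) := by
    by_cases hij : i = π i
    · refine le_trans (by norm_num) (Finset.sum_nonneg fun a _ => ?_)
      rw [← hij]
      exact mul_self_nonneg _
    · exact (abs_le.1 (hG.fixed i (π i) (b i) hij)).1
  have h3 := (abs_le.1 (hG.abs_meanScore_sub_le (b i) i (π i))).1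
  linarith

/-- A maximum over finitely many heads exceeds `τ` as soon as one head does, and stays below `τ` if
all do. Hence a tested pair is above the threshold exactly when it is an edge, and the rest follows
from this equivalence. -/
theorem Correct.of_scores {tested : Fin m → Fin m → Prop} {S : Fin h → Fin m → Fin m → ℝ} {τ : ℝ}
    (hedge : ∀ i, τ < S (b i) i (π i))
    (hnon : ∀ i j k, j ≠ π i → tested i j → S k i j < τ) :
    Correct π b tested S (fun i j => ⨆ k, S k i j) τ := by
  have hmax : ∀ i, τ < ⨆ k, S k i (π i) := fun i =>
    (hedge i).trans_le (le_ciSup (f := fun k => S k i (π i)) (Set.finite_range _).bddAbove (b i))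
  have hmax' : ∀ i j, j ≠ π i → tested i j → (⨆ k, S k i j) < τ := fun i j hj ht => by
    have : Nonempty (Fin h) := ⟨b i⟩
    obtain ⟨k, hk⟩ := exists_eq_ciSup_of_finite (f := fun k => S k i j)
    rw [← hk]
    exact hnon i j k hj ht
  have hiff : ∀ i j, tested i j → ((τ < ⨆ k, S k i j) ↔ j = π i) := fun i j ht =>
    ⟨fun hlt => by_contra fun hj => (hmax' i j hj ht).not_gt hlt, fun hj => hj ▸ hmax i⟩
  refine ⟨fun i => ⟨b i, rfl, hedge i, fun j hj ht => hnon i j _ hj ht⟩,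
    fun i => ⟨hmax i, hmax' i⟩, fun c i _ j _ ht => hiff i j ht, fun c i _ => ?_⟩
  by_cases hπ : π i ∈ c ∧ tested i (π i)
  · rw [if_pos hπ]
    have hu : ∃! j, j ∈ {j | j ∈ c ∧ tested i j} ∧ τ < ⨆ k, S k i j :=
      ⟨π i, ⟨hπ, hmax i⟩, fun j hj => (hiff i j hj.1.2).1 hj.2⟩
    rw [predict, dif_pos hu]
    have := hu.choose_spec.1
    exact congrArg some ((hiff i _ this.1.2).1 this.2)
  · rw [if_neg hπ, predict, dif_neg]
    rintro ⟨j, ⟨hj, hlt⟩, -⟩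
    obtain rfl := (hiff i j hj.2).1 hlt
    exact hπ hj

end Deterministic

/-! ### Correctness with high probability -/

section Probability

variable {m d dk h : ℕ}

/-- The normalised matrix of a sample whose rows all have norm at least `1 / 2`. -/
theorem embedding_eq_truncNormalize {x : Fin m → Fin d → ℝ} (hx : ∀ a, 1 / 4 ≤ x a ⬝ᵥ x a) :
    embedding x = Matrix.of fun a => truncNormalize (x a) :=
  funext fun a => embedding_apply_eq_truncNormalize (hx a)

/-- The deviation of a score from its mean over the signatures. -/
noncomputable def deviation (π : Equiv.Perm (Fin m)) (b : Fin m → Fin h) (k : Fin h) (i j : Fin m)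
    (ω : (Fin m → Fin d → ℝ) × (Fin m → Fin dk → ℝ)) : ℝ :=
  ∑ l, ((fun a => ω.2 a l) ⬝ᵥ queryCoeff π b (gram truncNormalize ω.1) k i) *
    ((fun a => ω.2 a l) ⬝ᵥ keyCoeff π b (gram truncNormalize ω.1) k j) -
  dk * (queryCoeff π b (gram truncNormalize ω.1) k i ⬝ᵥ
    keyCoeff π b (gram truncNormalize ω.1) k j)

theorem measurable_queryCoeff (π : Equiv.Perm (Fin m)) (b : Fin m → Fin h) (k : Fin h)
    (i : Fin m) :
    Measurable fun x : Fin m → Fin d → ℝ => queryCoeff π b (gram truncNormalize x) k i := by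
  refine measurable_pi_lambda _ fun c => ?_
  unfold queryCoeff
  split_ifs <;> fun_prop

theorem measurable_keyCoeff (π : Equiv.Perm (Fin m)) (b : Fin m → Fin h) (k : Fin h)
    (j : Fin m) :
    Measurable fun x : Fin m → Fin d → ℝ => keyCoeff π b (gram truncNormalize x) k j := by
  refine measurable_pi_lambda _ fun c => ?_
  unfold keyCoeff
  split_ifs <;> fun_prop

instance (m d : ℕ) : IsProbabilityMeasure (gaussianLaw m d) := by
  unfold gaussianLaw; infer_instance

instance (m dk : ℕ) : IsProbabilityMeasure (signatureLaw m dk) := by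
  unfold signatureLaw; infer_instance

instance (m d dk : ℕ) : IsProbabilityMeasure (drawLaw m d dk) := by
  unfold drawLaw; infer_instance

/-- The embeddings are frozen and the signature bound is applied to each section. The norm
conditions belong to the event, so that sections violating them are empty and the bound is uniform.
-/
theorem drawLaw_deviation (π : Equiv.Perm (Fin m)) (b : Fin m → Fin h) (k : Fin h)
    (i j : Fin m) :
    drawLaw m d dk {ω |
      queryCoeff π b (gram truncNormalize ω.1) k i ⬝ᵥ queryCoeff π b (gram truncNormalize ω.1) k i
        ≤ 33 ∧
      keyCoeff π b (gram truncNormalize ω.1) k j ⬝ᵥ keyCoeff π b (gram truncNormalize ω.1) k j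
        ≤ 33 ∧
      (dk : ℝ) / 8 ≤ |deviation π b k i j ω|} ≤ 2 * eexp (-(dk / 50000000)) := by
  have hq : Measurable fun ω : (Fin m → Fin d → ℝ) × (Fin m → Fin dk → ℝ) =>
      queryCoeff π b (gram truncNormalize ω.1) k i :=
    (measurable_queryCoeff π b k i).comp measurable_fst
  have hk : Measurable fun ω : (Fin m → Fin d → ℝ) × (Fin m → Fin dk → ℝ) =>
      keyCoeff π b (gram truncNormalize ω.1) k j :=
    (measurable_keyCoeff π b k j).comp measurable_fst
  have hW : ∀ l, Measurable fun ω : (Fin m → Fin d → ℝ) × (Fin m → Fin dk → ℝ) =>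
      fun a => ω.2 a l := fun l => by fun_prop
  have hdev : Measurable (deviation (d := d) (dk := dk) π b k i j) := by
    unfold deviation; fun_prop
  refine prod_measure_le_of_sections _ _ ?_ fun x => ?_
  · exact (measurableSet_le (measurable_dotProduct_comp hq hq) measurable_const).inter
      ((measurableSet_le (measurable_dotProduct_comp hk hk) measurable_const).inter
        (measurableSet_le measurable_const hdev.norm))
  · by_cases hu : queryCoeff π b (gram truncNormalize x) k i ⬝ᵥ
        queryCoeff π b (gram truncNormalize x) k i ≤ 33
    · by_cases hv : keyCoeff π b (gram truncNormalize x) k j ⬝ᵥ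
          keyCoeff π b (gram truncNormalize x) k j ≤ 33
      · refine le_trans (measure_mono ?_) (signatureLaw_deviation (dk := dk) hu hv)
        exact fun W hW => hW.2.2
      · simp [hv]
    · simp [hu]

/-- Outside the exceptional events, the construction is correct. -/
theorem constructionCorrect_of_typical (hdk : 0 < dk) {π : Equiv.Perm (Fin m)}
    {b : Fin m → Fin h} {tested : Fin m → Fin m → Prop}
    (ht : ∀ i j, tested i j → i ≠ j ∨ ∀ a, π a ≠ a)
    {ω : (Fin m → Fin d → ℝ) × (Fin m → Fin dk → ℝ)}
    (hG : IsTypical π b (gram truncNormalize ω.1)) (hω : ∀ a, 1 / 4 ≤ ω.1 a ⬝ᵥ ω.1 a)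
    (hdev : ∀ i j k, |deviation π b k i j ω| < dk / 8) : ConstructionCorrect π b tested ω := by
  have hdk' : (0 : ℝ) < dk := by exact_mod_cast hdk
  have hS : ∀ i j k, |headScore π b (embedding ω.1) ω.2 k i j -
      dk * meanScore π b (gram truncNormalize ω.1) k i j| < dk / 8 := fun i j k => by
    rw [embedding_eq_truncNormalize hω, headScore_eq, ← queryCoeff_dotProduct_keyCoeff]
    exact hdev i j k
  -- The margins are `3/4 - 1/8 > 1/2` and `1/4 + 1/8 < 1/2`.
  refine Correct.of_scores (fun i => ?_) fun i j k hj hij => ?_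
  · have h1 := (abs_lt.1 (hS i (π i) (b i))).1
    have h2 := mul_le_mul_of_nonneg_left (hG.le_meanScore i) hdk'.le
    linarith
  · have h1 := (abs_lt.1 (hS i j k)).2
    have h2 := mul_le_mul_of_nonneg_left
      (abs_le.1 (hG.abs_meanScore_le (k := k) hj (ht i j hij))).2 hdk'.le
    linarith

theorem drawLaw_not_constructionCorrect (hd : 0 < d) (hh : 0 < h) (hdk : 0 < dk)
    {π : Equiv.Perm (Fin m)} {b : Fin m → Fin h} (hb : ∀ k, (block b k).card = d)
    {tested : Fin m → Fin m → Prop} (ht : ∀ i j, tested i j → i ≠ j ∨ ∀ a, π a ≠ a) :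
    drawLaw m d dk {ω | ¬ ConstructionCorrect π b tested ω} ≤
      (m * (m * h) : ℕ) * (14 * eexp (-(d / 50000000)) + 2 * eexp (-(dk / 50000000))) := by
  set A : Set (Fin m → Fin d → ℝ) :=
    {x | ¬ (IsTypical π b (gram truncNormalize x) ∧ ∀ a, 1 / 4 ≤ x a ⬝ᵥ x a)} with hA
  set B : Fin m × Fin m × Fin h → (Fin m → Fin d → ℝ) × (Fin m → Fin dk → ℝ) → Prop := fun q ω =>
    queryCoeff π b (gram truncNormalize ω.1) q.2.2 q.1 ⬝ᵥ
      queryCoeff π b (gram truncNormalize ω.1) q.2.2 q.1 ≤ 33 ∧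
    keyCoeff π b (gram truncNormalize ω.1) q.2.2 q.2.1 ⬝ᵥ
      keyCoeff π b (gram truncNormalize ω.1) q.2.2 q.2.1 ≤ 33 ∧
    (dk : ℝ) / 8 ≤ |deviation π b q.2.2 q.1 q.2.1 ω| with hB
  have hsub : {ω | ¬ ConstructionCorrect π b tested ω} ⊆ A ×ˢ Set.univ ∪ {ω | ∃ q, B q ω} := by
    intro ω hω
    by_contra hcon
    rw [Set.mem_union, not_or] at hcon
    have hty := not_not.1 fun hc => hcon.1 (Set.mk_mem_prod (show ω.1 ∈ A from hc) trivial)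
    refine hω (constructionCorrect_of_typical hdk ht hty.1 hty.2 fun i j k => not_le.1 fun hc => ?_)
    exact hcon.2 ⟨(i, j, k), hty.1.queryCoeff_le k i, hty.1.keyCoeff_le k j, hc⟩
  have hBq : ∀ q, drawLaw m d dk {ω | B q ω} ≤ 2 * eexp (-(dk / 50000000)) := fun q =>
    drawLaw_deviation π b q.2.2 q.1 q.2.1
  calc _ ≤ _ := measure_mono hsub
    _ ≤ _ := measure_union_le _ _
    _ ≤ (m * (m * h) : ℕ) * (14 * eexp (-(d / 50000000))) +
        (m * (m * h) : ℕ) * (2 * eexp (-(dk / 50000000))) := by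
      refine add_le_add ?_ ?_
      · rw [drawLaw, Measure.prod_prod, measure_univ, mul_one]
        exact gaussianLaw_not_typical hd hh π b hb
      · refine (measure_exists_le (drawLaw m d dk) hBq).trans_eq ?_
        simp only [Fintype.card_prod, Fintype.card_fin]
    _ = _ := (mul_add _ _ _).symm

theorem eexp_le_of_log_le {t : ℝ} (hm : 0 < m) (ht : 1000000000 * Real.log m ≤ t) :
    eexp (-(t / 50000000)) ≤ ENNReal.ofReal (1 / (m : ℝ) ^ 20) := by
  have hm' : (0 : ℝ) < m := by exact_mod_cast hm
  refine ENNReal.ofReal_le_ofReal ?_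
  calc Real.exp (-(t / 50000000)) ≤ Real.exp (-((20 : ℕ) * Real.log m)) :=
        Real.exp_le_exp.2 (by push_cast; linarith)
    _ = _ := by rw [Real.exp_neg, Real.exp_nat_mul, Real.exp_log hm', one_div]

theorem le_drawLaw_constructionCorrect (hm : 2 ≤ m) (hd : 0 < d) (hh : 0 < h) (hmhd : m = h * d)
    (hdm : 1000000000 * Real.log m ≤ d) (hdkm : 1000000000 * Real.log m ≤ dk)
    {π : Equiv.Perm (Fin m)} {b : Fin m → Fin h} (hb : ∀ k, (block b k).card = d)
    {tested : Fin m → Fin m → Prop} (ht : ∀ i j, tested i j → i ≠ j ∨ ∀ a, π a ≠ a) :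
    1 - 1 / (m : ℝ) ^ 3 ≤ (drawLaw m d dk).real {ω | ConstructionCorrect π b tested ω} := by
  have hm0 : (2 : ℝ) ≤ m := by exact_mod_cast hm
  have hdk : 0 < dk := by
    have : 0 < Real.log m := Real.log_pos (by linarith)
    have : (0 : ℝ) < dk := by linarith
    exact_mod_cast this
  have hhm : h ≤ m := by rw [hmhd]; exact Nat.le_mul_of_pos_right h hd
  have hbad : drawLaw m d dk {ω | ¬ ConstructionCorrect π b tested ω} ≤
      ENNReal.ofReal (1 / (m : ℝ) ^ 3) := by
    calc _ ≤ _ := drawLaw_not_constructionCorrect hd hh hdk hb ht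
      _ ≤ (m ^ 3 : ℕ) * (14 * ENNReal.ofReal (1 / (m : ℝ) ^ 20) +
          2 * ENNReal.ofReal (1 / (m : ℝ) ^ 20)) := by
        gcongr
        · calc m * (m * h) ≤ m * (m * m) := by gcongr
            _ = m ^ 3 := by ring
        · exact eexp_le_of_log_le (by omega) hdm
        · exact eexp_le_of_log_le (by omega) hdkm
      _ = ENNReal.ofReal ((m : ℝ) ^ 3 * (16 * (1 / (m : ℝ) ^ 20))) := by
        rw [← add_mul, ENNReal.ofReal_mul (by positivity), ENNReal.ofReal_mul (by norm_num),
          ENNReal.ofReal_pow (Nat.cast_nonneg m), ENNReal.ofReal_natCast]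
        push_cast
        norm_num
      _ ≤ _ := by
        refine ENNReal.ofReal_le_ofReal ?_
        -- The `m³` triples, each with failure probability at most `16 / m²⁰`, leave room for the
        -- target `1 / m³`.
        have h14 : (16 : ℝ) ≤ (m : ℝ) ^ 14 :=
          le_trans (by norm_num) (pow_le_pow_left₀ (by norm_num) hm0 14)
        have hm1 : (0 : ℝ) < m := by linarith
        rw [mul_one_div, mul_div_assoc', div_le_div_iff₀ (by positivity) (by positivity)]
        calc (m : ℝ) ^ 3 * 16 * (m : ℝ) ^ 3 ≤ (m : ℝ) ^ 3 * (m : ℝ) ^ 14 * (m : ℝ) ^ 3 := by gcongr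
          _ = 1 * (m : ℝ) ^ 20 := by ring
  have hreal : (drawLaw m d dk).real {ω | ¬ ConstructionCorrect π b tested ω} ≤
      1 / (m : ℝ) ^ 3 := ENNReal.toReal_le_of_le_ofReal (by positivity) hbad
  -- Subadditivity gives the lower bound without measurability of the correctness event.
  have hun := measureReal_union_le (μ := drawLaw m d dk) {ω | ConstructionCorrect π b tested ω}
    {ω | ¬ ConstructionCorrect π b tested ω}
  have huniv : {ω | ConstructionCorrect (d := d) (dk := dk) π b tested ω} ∪
      {ω | ¬ ConstructionCorrect π b tested ω} = Set.univ :=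
    Set.eq_univ_of_forall fun ω => em _
  rw [huniv, probReal_univ] at hun
  linarith

end Probability

end RGR

/-! ### Choice of constants and the total key dimension -/

theorem mainTheorem1 :
    ∃ C₀ c₀ : ℝ, 0 < C₀ ∧ 0 < c₀ ∧ ∀ C : ℝ, C₀ ≤ C →
      ∃ a A : ℝ, 0 < a ∧ 0 < A ∧
        ∀ (m d h : ℕ), 0 < d → 0 < h → m = h * d → c₀ * Real.log m ≤ d →
          (∀ (π : Equiv.Perm (Fin m)) (b : Fin m → Fin h),
            (∀ k, (Finset.univ.filter fun i => b i = k).card = d) →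
              1 - 1 / (m : ℝ) ^ 3 ≤ (RGR.drawLaw m d (RGR.headDim C m)).real
                {ω | RGR.ConstructionCorrect π b (fun i j => i ≠ j) ω} ∧
              ((∀ i, π i ≠ i) →
                1 - 1 / (m : ℝ) ^ 3 ≤ (RGR.drawLaw m d (RGR.headDim C m)).real
                  {ω | RGR.ConstructionCorrect π b (fun _ _ => True) ω})) ∧
          a * (m * Real.log m / d) ≤ RGR.totalKeyDim h (RGR.headDim C m) ∧
          (RGR.totalKeyDim h (RGR.headDim C m) : ℝ) ≤ A * (m * Real.log m / d) := by
  refine ⟨1000000000, 1000000000, by norm_num, by norm_num, fun C hC => ?_⟩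
  have hC0 : 0 < C := by linarith
  have hlog2 : 0 < Real.log 2 := Real.log_pos (by norm_num)
  -- The term `1 / log 2` absorbs the rounding in `headDim`, since `1 ≤ log m / log 2` for `m ≥ 2`.
  refine ⟨C, C + 1 / Real.log 2, hC0, by positivity, fun m d h hd hh hmhd hdm => ?_⟩
  have hm : 0 < m := by rw [hmhd]; positivity
  have hlog : 0 ≤ Real.log m := Real.log_natCast_nonneg m
  have hdk : C * Real.log m ≤ RGR.headDim C m := Nat.le_ceil _
  have hdk' : 1000000000 * Real.log m ≤ RGR.headDim C m :=
    (mul_le_mul_of_nonneg_right hC hlog).trans hdk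
  have hd' : (0 : ℝ) < d := by exact_mod_cast hd
  have hratio : (m : ℝ) * Real.log m / d = h * Real.log m := by
    have : (m : ℝ) = h * d := by exact_mod_cast hmhd
    nth_rewrite 1 [this]
    field_simp
  have htotal : (RGR.totalKeyDim h (RGR.headDim C m) : ℝ) = h * RGR.headDim C m := by
    simp [RGR.totalKeyDim]
  rw [hratio, htotal]
  rcases Nat.lt_or_ge m 2 with hm2 | hm2
  -- Here `log m = 0`: the head dimension vanishes and the probability bound is `1 - 1 = 0`.
  · obtain rfl : m = 1 := by omega
    refine ⟨fun π b _ => ?_, ?_, ?_⟩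
    · norm_num
    · simp [RGR.headDim]
    · simp [RGR.headDim]
  · refine ⟨fun π b hb => ⟨?_, fun hπ => ?_⟩, ?_, ?_⟩
    · exact RGR.le_drawLaw_constructionCorrect hm2 hd hh hmhd hdm hdk' hb fun i j hij => Or.inl hij
    · exact RGR.le_drawLaw_constructionCorrect hm2 hd hh hmhd hdm hdk' hb fun _ _ _ => Or.inr hπ
    · rw [mul_left_comm]
      exact mul_le_mul_of_nonneg_left hdk (Nat.cast_nonneg h)
    · rw [mul_left_comm]
      refine mul_le_mul_of_nonneg_left ?_ (Nat.cast_nonneg h)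
      have h1 : (RGR.headDim C m : ℝ) < C * Real.log m + 1 := Nat.ceil_lt_add_one (by positivity)
      have h2 : 1 ≤ 1 / Real.log 2 * Real.log m := by
        rw [one_div, inv_mul_eq_div, le_div_iff₀ hlog2, one_mul]
        exact Real.log_le_log (by norm_num) (by exact_mod_cast hm2)
      rw [add_mul]
      linarith
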